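/- **Proposition 4.4 (interlacing).** Let $A(x)=A_0x_0+A_1x_1+A_2x_2+A_3x_3$ with real symmetric $4\times4$ matrices $A_i$, let $f=\det A(x)$, let $X=V(f)\subset\mathbb{CP}^3$ be the corresponding very real quartic symmetroid, and let $S=\{x\in\mathbb{RP}^3 : A(x)\text{ is positive or negative semidefinite}\}$ be its spectrahedron. Let $p\in\mathbb{RP}^3$ be a $(1,1)$-node of $X$: the point $p$ is a node of $X$ (a singular point whose tangent cone is a nondegenerate quadratic cone), and $A(p)$ has exactly one positive and exactly one negative eigenvalue. Assume that $X$ contains no complex line through $p$. Choose real coordinates with $p=(1:0:0:0)$ and a real congruence after which $A(x)=x_0(E_{12}+E_{21})+M(x_1,x_2,x_3)$, where $E_{12}+E_{21}$ has entries $1$ at $(1,2)$ and $(2,1)$ and $0$ elsewhere. Let $\pi_p:(x_0:x_1:x_2:x_3)\mapsto(x_1:x_2:x_3)$ be the projection from $p$. Write $f=ax_0^2+bx_0+c$ with $a,b,c\in\mathbb{R}[x_1,x_2,x_3]$; let $C_p=V(a)$ be the conic that is the image of the tangent cone at $p$, and let $R_1$, $R_2$ be the ramification cubics, that is, the diagonal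 cofactors of $M$ at the positions $(1,1)$ and $(2,2)$, for which $V(b^2-4ac)=R_1\cup R_2$. For $e\in\mathbb{R}^3$ we say that the conic $C_p=V(a)$ *interlaces* a cubic $V(h)$ with respect to $e$ if $a(e)\neq0$, $h(e)\ne0$, and for each $x\in\mathbb{R}^3$ the polynomials $h(te+x)$ and $a(te+x)$ in $t$ have only real roots $\alpha_1\le\alpha_2\le\alpha_3$ and $\beta_1\le\beta_2$ (with multiplicity) with $\alpha_1\le\beta_1\le\alpha_2\le\beta_2\le\alpha_3$. Then the *oval* of $V(h)$ around $e$ is the boundary of the connected component of $\mathbb{RP}^2\setminus V(h)$ that contains $e$ (if $V(h)$ is smooth, this is its unique oval). 1. $S$ has non-empty interior in $\mathbb{RP}^3$ if and only if there is a point $e\in\mathbb{R}^3$ with respect to which $C_p$ interlaces both $R_1$ and $R_2$. 2. If every real singular point of $X$ that lies on $S$ is a node at which $A$ has rank two (for instance, if all singular points of $X$ are nodes of rank two), then $S$ is non-empty if and only if there is such a point $e$. 3. For each $e$ with respect to which $C_p$ interlaces both $R_1$ and $R_2$, the image $\pi_p(S)$ is the intersection of the convex hulls of the ovals of $R_1$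 and of $R_2$ around $e$. -/

import Mathlib

open scoped Matrix LinearAlgebra.Projectivization

noncomputable section

namespace Symmetroid

/-! ### Linear matrix pencils and their determinants -/

/-- The matrix `A(x) = ∑ i, x i • A i`. -/
def matAt {m : ℕ} {n : ℕ} (A : Fin m → Matrix (Fin n) (Fin n) ℝ) (x : Fin m → ℝ) :
    Matrix (Fin n) (Fin n) ℝ :=
  ∑ i, x i • A i

/-- The determinant of `A(x)` as a polynomial in the variables `x`. -/
def detForm {m : ℕ} {n : ℕ} (A : Fin m → Matrix (Fin n) (Fin n) ℝ) : MvPolynomial (Fin m) ℝ :=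
  (∑ i, (MvPolynomial.X i : MvPolynomial (Fin m) ℝ) • (A i).map MvPolynomial.C).det

/-- A real symmetric matrix that is positive or negative semidefinite. -/
def IsSemidefinite {n : ℕ} (M : Matrix (Fin n) (Fin n) ℝ) : Prop :=
  M.PosSemidef ∨ (-M).PosSemidef

/-- `M` has exactly `a` positive and exactly `b` negative eigenvalues, with multiplicities. -/
def HasSignature {n : ℕ} (M : Matrix (Fin n) (Fin n) ℝ) (a b : ℕ) : Prop :=
  Multiset.card (M.charpoly.roots.filter (fun r => 0 < r)) = a ∧
    Multiset.card (M.charpoly.roots.filter (fun r => r < 0)) = b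

/-- The spectrahedron in real projective space: the points at which `A(x)` is semidefinite. -/
def spectrahedron (A : Fin 4 → Matrix (Fin 4) (Fin 4) ℝ) : Set (ℙ ℝ (Fin 4 → ℝ)) :=
  {x | IsSemidefinite (matAt A x.rep)}

/-- A subset of a real projective space has an interior point. Since the quotient map from the
nonzero vectors is open and continuous, this can be tested on the affine cone over the set. -/
def HasInteriorPoint {n : ℕ} (S : Set (ℙ ℝ (Fin n → ℝ))) : Prop :=
  (interior {v : Fin n → ℝ | ∀ hv : v ≠ 0, Projectivization.mk ℝ v hv ∈ S}).Nonempty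

/-! ### The surface `V(f)` in complex projective 3-space -/

/-- The real point with homogeneous coordinates `x` is a singular point of `V(f)`. -/
def IsSingularPoint (f : MvPolynomial (Fin 4) ℝ) (x : Fin 4 → ℝ) : Prop :=
  x ≠ 0 ∧ MvPolynomial.eval x f = 0 ∧ ∀ i, MvPolynomial.eval x (MvPolynomial.pderiv i f) = 0

/-- The real point with homogeneous coordinates `x` is a node of `V(f)`: a singular point whose
tangent cone is a nondegenerate quadratic cone. (At a singular point `x` of a surface of degree at
least two, `x` is in the kernel of the Hessian, so that `3` is the largest possible rank.) -/
def IsNode (f : MvPolynomial (Fin 4) ℝ) (x : Fin 4 → ℝ) : Prop :=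
  IsSingularPoint f x ∧
    (Matrix.of fun i j => MvPolynomial.eval x
      (MvPolynomial.pderiv i (MvPolynomial.pderiv j f))).rank = 3

/-- The surface `V(f)` in complex projective space contains a (complex) line through the real
point `p`, namely the line spanned by `p` and some second point `v`. -/
def ContainsLineThrough (f : MvPolynomial (Fin 4) ℝ) (p : Fin 4 → ℝ) : Prop :=
  ∃ v : Fin 4 → ℂ, LinearIndependent ℂ ![(fun i => (p i : ℂ)), v] ∧
    ∀ s t : ℂ, MvPolynomial.aeval (s • (fun i => (p i : ℂ)) + t • v) f = 0

/-! ### Projection from a node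

`T` is a linear change of homogeneous coordinates which takes `(1 : 0 : 0 : 0)` to the centre of the
projection, and the projection is `T (x₀, x₁, x₂, x₃) ↦ (x₁ : x₂ : x₃)`. -/

/-- The pencil `x ↦ A (T x)`. -/
def inCoords (A : Fin 4 → Matrix (Fin 4) (Fin 4) ℝ) (T : (Fin 4 → ℝ) ≃ₗ[ℝ] (Fin 4 → ℝ)) :
    Fin 4 → Matrix (Fin 4) (Fin 4) ℝ :=
  fun i => matAt A (T (Pi.single i 1))

/-- The image of `S` under the projection from the point `T (1, 0, 0, 0)`. -/
def projectionImage (T : (Fin 4 → ℝ) ≃ₗ[ℝ] (Fin 4 → ℝ)) (S : Set (ℙ ℝ (Fin 4 → ℝ))) :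
    Set (ℙ ℝ (Fin 3 → ℝ)) :=
  {y | ∃ (t : ℝ) (v : Fin 3 → ℝ) (hv : v ≠ 0)
      (hx : T (Fin.cons t v : Fin 4 → ℝ) ≠ 0),
      Projectivization.mk ℝ (T (Fin.cons t v : Fin 4 → ℝ)) hx ∈ S ∧
        Projectivization.mk ℝ v hv = y}

/-- The coefficient of `x₀ ^ k` in `f`, as a polynomial in the remaining three variables. -/
def coeffX0 (f : MvPolynomial (Fin 4) ℝ) (k : ℕ) : MvPolynomial (Fin 3) ℝ :=
  (MvPolynomial.finSuccEquiv ℝ 3 f).coeff k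

/-- If `(1 : 0 : 0 : 0)` is a node of `V(f)` and `f = a x₀² + b x₀ + c`, the equation `a` of the
tangent cone at the node; its zero set in the plane is the conic `C_p`. -/
def tangentConic (f : MvPolynomial (Fin 4) ℝ) : MvPolynomial (Fin 3) ℝ :=
  coeffX0 f 2

/-- If `(1 : 0 : 0 : 0)` is a node of `V(f)` and `f = a x₀² + b x₀ + c`, the equation
`b² - 4ac` of the ramification curve of the projection from the node. -/
def ramificationSextic (f : MvPolynomial (Fin 4) ℝ) : MvPolynomial (Fin 3) ℝ :=
  coeffX0 f 1 ^ 2 - 4 * coeffX0 f 2 * coeffX0 f 0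

/-- The normal form of `A(p)` at a `(1,1)`-node. -/
def nodeNormalForm : Matrix (Fin 4) (Fin 4) ℝ :=
  !![0, 1, 0, 0; 1, 0, 0, 0; 0, 0, 0, 0; 0, 0, 0, 0]

/-- For a pencil `B(x) = x₀ B₀ + M(x₁, x₂, x₃)`, the `k`-th diagonal cofactor of `M`. If `B₀` is the
normal form above, then the cofactors for `k = 0` and `k = 1` are the two ramification cubics. -/
def diagCofactor (B : Fin 4 → Matrix (Fin 4) (Fin 4) ℝ) (k : Fin 4) : MvPolynomial (Fin 3) ℝ :=
  detForm fun j : Fin 3 => (B j.succ).submatrix k.succAbove k.succAbove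

/-- The two ramification cubics (`k = 0, 1`), in coordinates `T` on space in which the node is
`(1 : 0 : 0 : 0)`, and for a congruence `P` which brings the matrix of the node into normal form. -/
def ramificationCubic (A : Fin 4 → Matrix (Fin 4) (Fin 4) ℝ)
    (T : (Fin 4 → ℝ) ≃ₗ[ℝ] (Fin 4 → ℝ)) (P : Matrix (Fin 4) (Fin 4) ℝ) (k : Fin 4) :
    MvPolynomial (Fin 3) ℝ :=
  diagCofactor (fun i => Pᵀ * inCoords A T i * P) k


theorem detForm_congr {m n : ℕ} (A : Fin m → Matrix (Fin n) (Fin n) ℝ)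
    (P : Matrix (Fin n) (Fin n) ℝ) :
    detForm (fun i => Pᵀ * A i * P) = MvPolynomial.C (P.det ^ 2) * detForm A := by
  have h : (∑ i, (MvPolynomial.X i : MvPolynomial (Fin m) ℝ) •
        (Pᵀ * A i * P).map (MvPolynomial.C : ℝ →+* MvPolynomial (Fin m) ℝ)) =
      (P.map MvPolynomial.C)ᵀ * (∑ i, (MvPolynomial.X i : MvPolynomial (Fin m) ℝ) •
        (A i).map (MvPolynomial.C : ℝ →+* MvPolynomial (Fin m) ℝ)) * P.map MvPolynomial.C := by
    rw [Finset.mul_sum, Finset.sum_mul]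
    refine Finset.sum_congr rfl fun i _ => ?_
    rw [Matrix.map_mul, Matrix.map_mul, Matrix.mul_smul, Matrix.smul_mul, Matrix.transpose_map]
  have hdet : (P.map (MvPolynomial.C : ℝ →+* MvPolynomial (Fin m) ℝ)).det =
      MvPolynomial.C P.det := by
    rw [RingHom.map_det]; rfl
  simp only [detForm]
  rw [h, Matrix.det_mul, Matrix.det_mul, Matrix.det_transpose, hdet, map_pow]
  ring

/-- The two ramification cubics are the components of the ramification curve: their product is,
up to a positive constant, the discriminant `b² - 4ac`. -/
theorem ramificationSextic_eq (A : Fin 4 → Matrix (Fin 4) (Fin 4) ℝ) (hA : ∀ i, (A i).IsSymm)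
    (T : (Fin 4 → ℝ) ≃ₗ[ℝ] (Fin 4 → ℝ)) (P : Matrix (Fin 4) (Fin 4) ℝ)
    (hP : Pᵀ * matAt A (T (Pi.single 0 1)) * P = nodeNormalForm) :
    MvPolynomial.C (P.det ^ 4) * ramificationSextic (detForm (inCoords A T)) =
      4 * (ramificationCubic A T P 0 * ramificationCubic A T P 1) := by
  set B : Fin 4 → Matrix (Fin 4) (Fin 4) ℝ := fun i => Pᵀ * inCoords A T i * P with hB
  have hB0 : B 0 = nodeNormalForm := hP
  have hsym : ∀ k i j, B k i j = B k j i := by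
    intro k i j
    have h1 : (inCoords A T k)ᵀ = inCoords A T k := by
      simp only [inCoords, matAt, Matrix.transpose_sum, Matrix.transpose_smul]
      exact Finset.sum_congr rfl fun i _ => by rw [(hA i).eq]
    have h2 : (B k)ᵀ = B k := by
      simp only [hB, Matrix.transpose_mul, Matrix.transpose_transpose, h1, Matrix.mul_assoc]
    exact congrFun (congrFun h2 j) i
  let M : Matrix (Fin 4) (Fin 4) (MvPolynomial (Fin 3) ℝ) :=
    ∑ k : Fin 3, (MvPolynomial.X k : MvPolynomial (Fin 3) ℝ) • (B k.succ).map MvPolynomial.C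
  have hM : ∀ i j, M i j = ∑ k : Fin 3, MvPolynomial.X k * MvPolynomial.C (B k.succ i j) := by
    intro i j
    simp [M, Matrix.sum_apply]
  have hMsym : ∀ i j, M i j = M j i := by
    intro i j
    simp only [hM]
    exact Finset.sum_congr rfl fun k _ => by rw [hsym]
  have hcof : ∀ k : Fin 4, ramificationCubic A T P k =
      (M.submatrix k.succAbove k.succAbove).det := by
    intro k
    simp only [ramificationCubic, diagCofactor, detForm]
    congr 1
  have hC : ∀ r : ℝ, MvPolynomial.finSuccEquiv ℝ 3 (MvPolynomial.C r) =
      Polynomial.C (MvPolynomial.C r) := fun r => by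
    simp [MvPolynomial.finSuccEquiv_apply]
  have hf : MvPolynomial.finSuccEquiv ℝ 3 (detForm B) =
      (Matrix.of fun i j => Polynomial.X * Polynomial.C (MvPolynomial.C (nodeNormalForm i j)) +
        Polynomial.C (M i j)).det := by
    simp only [detForm]
    rw [AlgEquiv.map_det]
    congr 1
    ext1 i j
    rw [Fin.sum_univ_succ]
    simp only [AlgEquiv.mapMatrix_apply, Matrix.map_apply, Matrix.add_apply, Matrix.smul_apply,
      Matrix.sum_apply, map_add, map_sum, map_mul, smul_eq_mul, hC, Matrix.of_apply,
      MvPolynomial.finSuccEquiv_X_zero, MvPolynomial.finSuccEquiv_X_succ, hB0, hM]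
  have h10 := hMsym 1 0
  have h20 := hMsym 2 0
  have h30 := hMsym 3 0
  have h21 := hMsym 2 1
  have h31 := hMsym 3 1
  have h32 := hMsym 3 2
  obtain ⟨Q, hQ⟩ : ∃ Q, Q = M 2 2 * M 3 3 - M 2 3 ^ 2 := ⟨_, rfl⟩
  obtain ⟨G, hG⟩ : ∃ G, G = -(M 0 1 * Q) + M 0 2 * (M 1 2 * M 3 3 - M 1 3 * M 2 3) -
      M 0 3 * (M 1 2 * M 2 3 - M 1 3 * M 2 2) := ⟨_, rfl⟩
  obtain ⟨D, hD⟩ : ∃ D, D = M.det := ⟨_, rfl⟩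
  have hf' : MvPolynomial.finSuccEquiv ℝ 3 (detForm B) =
      Polynomial.C (-Q) * Polynomial.X ^ 2 + Polynomial.C (G + G) * Polynomial.X +
        Polynomial.C D := by
    rw [hf, hD, hG, hQ]
    simp [Matrix.det_succ_row_zero, Fin.sum_univ_succ, nodeNormalForm, Fin.succAbove, h10, h20,
      h30, h21, h31, h32]
    ring
  have hc : detForm B = MvPolynomial.C (P.det ^ 2) * detForm (inCoords A T) :=
    detForm_congr (inCoords A T) P
  have hram : ramificationSextic (detForm B) =
      MvPolynomial.C (P.det ^ 4) * ramificationSextic (detForm (inCoords A T)) := by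
    have hk : ∀ k, coeffX0 (detForm B) k =
        MvPolynomial.C (P.det ^ 2) * coeffX0 (detForm (inCoords A T)) k := by
      intro k
      rw [hc, coeffX0, map_mul, hC, Polynomial.coeff_C_mul, coeffX0]
    simp only [ramificationSextic, hk, map_pow]
    ring
  have h0 : coeffX0 (detForm B) 0 = D := by
    rw [coeffX0, hf']
    simp only [Polynomial.coeff_add, Polynomial.coeff_C_mul, Polynomial.coeff_X_pow,
      Polynomial.coeff_X, Polynomial.coeff_C]
    simp
  have h1 : coeffX0 (detForm B) 1 = G + G := by
    rw [coeffX0, hf']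
    simp only [Polynomial.coeff_add, Polynomial.coeff_C_mul, Polynomial.coeff_X_pow,
      Polynomial.coeff_X, Polynomial.coeff_C]
    simp
  have h2 : coeffX0 (detForm B) 2 = -Q := by
    rw [coeffX0, hf']
    simp only [Polynomial.coeff_add, Polynomial.coeff_C_mul, Polynomial.coeff_X_pow,
      Polynomial.coeff_X, Polynomial.coeff_C]
    simp
  rw [← hram, hcof, hcof, ramificationSextic, h0, h1, h2, hG, hD, hQ]
  simp [Matrix.det_succ_row_zero, Fin.sum_univ_succ, Fin.succAbove, h10, h20, h30, h21, h31, h32]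
  ring

/-! ### Interlacing and ovals -/

/-- The form `h` of degree `d` interlaces the form `f` of degree `d + 1` with respect to `e`:
for each `x`, the polynomials `f (t e + x)` and `h (t e + x)` in `t` have `d + 1` and `d` real roots
`α₀ ≤ ... ≤ α_d` and `β₀ ≤ ... ≤ β_{d-1}`, counted with multiplicity, and `α_i ≤ β_i ≤ α_{i+1}`.
(The coefficients of `t ^ (d + 1)` and `t ^ d` are `f e` and `h e`.) -/
def Interlaces (d : ℕ) (h f : MvPolynomial (Fin 3) ℝ) (e : Fin 3 → ℝ) : Prop :=
  MvPolynomial.eval e f ≠ 0 ∧ MvPolynomial.eval e h ≠ 0 ∧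
    ∀ x : Fin 3 → ℝ, ∃ (α : Fin (d + 1) → ℝ) (β : Fin d → ℝ),
      (∀ t : ℝ, MvPolynomial.eval (t • e + x) f = MvPolynomial.eval e f * ∏ i, (t - α i)) ∧
      (∀ t : ℝ, MvPolynomial.eval (t • e + x) h = MvPolynomial.eval e h * ∏ i, (t - β i)) ∧
      ∀ i : Fin d, α i.castSucc ≤ β i ∧ β i ≤ α i.succ

/-- One half of the affine cone over the oval around `e` of a hyperbolic plane cubic `V(h)`: the
boundary of the connected component of `e` in the complement of the curve. If the cubic is smooth,
then this oval is the only component of the real curve which disconnects the projective plane. As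
`h` has odd degree, the component of `e` in `{h ≠ 0} ⊆ ℝ³` does not contain `-e`, so that it is one
half of the cone over the component in the projective plane. -/
def ovalHalfCone (h : MvPolynomial (Fin 3) ℝ) (e : Fin 3 → ℝ) : Set (Fin 3 → ℝ) :=
  frontier (connectedComponentIn {x | MvPolynomial.eval x h ≠ 0} e)

/-- The convex hull, in the projective plane, of the oval of `V(h)` around `e`: the image of the
convex hull of the half cone over the oval. (In each affine chart of the plane that contains the
oval, this is the convex hull in the usual sense.) -/
def ovalHull (h : MvPolynomial (Fin 3) ℝ) (e : Fin 3 → ℝ) : Set (ℙ ℝ (Fin 3 → ℝ)) :=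
  {y | ∃ (v : Fin 3 → ℝ) (hv : v ≠ 0),
    v ∈ convexHull ℝ (ovalHalfCone h e) ∧ Projectivization.mk ℝ v hv = y}

end Symmetroid

end

/-!
Write the pencil in the given coordinates as `x₀ E + M(y)`, where `E` is the normal form of the node
and `y = (x₁, x₂, x₃)`. The variable `x₀` occurs only in the entry `(0, 1)`, so that whether some
`x₀ E + M(y)` is positive definite is a matrix completion problem: this is the case if and only if
both `3 × 3` principal submatrices `M₀(y)` and `M₁(y)` obtained by deleting row and column `0` or `1`
are positive definite (`exists_posDef_completion`), and similarly for semidefiniteness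
(`exists_posSemidef_completion`). The ramification cubics are the determinants of `M₀` and `M₁`, and
the tangent conic is, up to a constant, the determinant of their common lower right block `N`.
Hence the projection of the spectrahedron is the intersection of the two plane spectrahedra
`{M₀ ⪰ 0}` and `{M₁ ⪰ 0}`, and these are the convex hulls of the ovals (`ovalHull_eq_of_definite`).

It remains to relate interlacing and definiteness. If `M₀(e)` and `M₁(e)` are definite, then the
conic interlaces both cubics by Cauchy's theorem (`interlaces_of_posDef`). Conversely, as the
tangent cone at the node is nondegenerate, the entries of `N` are coordinates on `ℝ³`
(`exists_matAt_eq_of_rank_hessian`), so that the conic has signature `(1, 2)`, and hyperbolicity of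
the conic makes `N(e)` definite. If `M₀(e)` were indefinite, then the interlacing inequalities would
make the determinant of `M₀`, which has constant sign on the half cone over the conic where `N` is
semidefinite, vanish there (`det_vanishes_on_conic`); that is, over the conic, row `1` of `M` annihilates the kernel of `N`. Row
`0` does so at some real point of the conic, since this is the vanishing of a binary cubic form
(`exists_point_on_conic`). There, the kernel vector of `N` is a common kernel vector of `E` and `M`,
and the line through this point and the node lies on the surface, which is excluded. Altogether,
interlacing is equivalent to the existence of a definite matrix in the pencil, that is, to the
spectrahedron having an interior point (`hasInteriorPoint_spectrahedron_iff`).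

Finally, a semidefinite matrix in the pencil can be moved to a definite one if its point is not
singular or is a node of rank two: the first or second order term of the determinant shows that the
pencil takes a positive definite value on its kernel (`exists_posDef_of_posSemidef`).
-/

namespace Symmetroid

open Matrix Topology Filter

/-! ### Definite and semidefinite matrices -/

theorem posSemidef_iff_of_isSymm {n : ℕ} {M : Matrix (Fin n) (Fin n) ℝ} (hM : M.IsSymm) :
    M.PosSemidef ↔ ∀ z : Fin n → ℝ, 0 ≤ z ⬝ᵥ M *ᵥ z := by
  rw [posSemidef_iff_dotProduct_mulVec]
  simp only [star_trivial]
  exact and_iff_right ((conjTranspose_eq_transpose_of_trivial M).trans hM)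

theorem posDef_iff_of_isSymm {n : ℕ} {M : Matrix (Fin n) (Fin n) ℝ} (hM : M.IsSymm) :
    M.PosDef ↔ ∀ z : Fin n → ℝ, z ≠ 0 → 0 < z ⬝ᵥ M *ᵥ z := by
  rw [posDef_iff_dotProduct_mulVec]
  simp only [star_trivial]
  exact and_iff_right ((conjTranspose_eq_transpose_of_trivial M).trans hM)

theorem posDef_iff_forall_mem_sphere {n : ℕ} {M : Matrix (Fin n) (Fin n) ℝ} (hM : M.IsSymm) :
    M.PosDef ↔ ∀ z ∈ Metric.sphere (0 : Fin n → ℝ) 1, 0 < z ⬝ᵥ M *ᵥ z := by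
  rw [posDef_iff_of_isSymm hM]
  constructor
  · intro h z hz
    exact h z (by rintro rfl; simp at hz)
  · intro h z hz
    have h1 := h (‖z‖⁻¹ • z) (by simp [norm_smul, norm_ne_zero_iff.mpr hz])
    rw [mulVec_smul, smul_dotProduct, dotProduct_smul, smul_eq_mul, smul_eq_mul, ← mul_assoc] at h1
    exact pos_of_mul_pos_right h1 (by positivity)

theorem isClosed_posSemidef {X : Type*} [TopologicalSpace X] {n : ℕ}
    {F : X → Matrix (Fin n) (Fin n) ℝ} (hF : Continuous F) (hsymm : ∀ x, (F x).IsSymm) :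
    IsClosed {x | (F x).PosSemidef} := by
  simp only [posSemidef_iff_of_isSymm (hsymm _), Set.ofPred_forall]
  exact isClosed_iInter fun z => isClosed_le continuous_const (by fun_prop)

theorem isOpen_posDef {X : Type*} [TopologicalSpace X] {n : ℕ}
    {F : X → Matrix (Fin n) (Fin n) ℝ} (hF : Continuous F) (hsymm : ∀ x, (F x).IsSymm) :
    IsOpen {x | (F x).PosDef} := by
  rw [isOpen_iff_mem_nhds]
  intro x hx
  simp only [Set.mem_ofPred_eq, posDef_iff_forall_mem_sphere (hsymm _)] at hx ⊢
  refine (isCompact_sphere 0 1).eventually_forall_of_forall_eventually fun z hz => ?_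
  have hc : Continuous fun w : X × (Fin n → ℝ) => w.2 ⬝ᵥ F w.1 *ᵥ w.2 := by fun_prop
  exact hc.continuousAt.eventually (lt_mem_nhds (hx z hz))

/-- A positive semidefinite matrix becomes positive definite after a small step in any direction
that is positive definite on its kernel. -/
theorem exists_posDef_add_smul {n : ℕ} {M D : Matrix (Fin n) (Fin n) ℝ} (hM : M.PosSemidef)
    (hD : D.IsSymm) (h : ∀ z : Fin n → ℝ, z ≠ 0 → M *ᵥ z = 0 → 0 < z ⬝ᵥ D *ᵥ z) :
    ∃ ε : ℝ, 0 < ε ∧ (M + ε • D).PosDef := by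
  have hMs : M.IsSymm := (conjTranspose_eq_transpose_of_trivial M).symm.trans hM.1
  have hquad : ∀ z, 0 ≤ z ⬝ᵥ M *ᵥ z := (posSemidef_iff_of_isSymm hMs).1 hM
  have key : ∀ᶠ ε : ℝ in 𝓝 0, ∀ z ∈ Metric.sphere (0 : Fin n → ℝ) 1,
      0 < ε → 0 < z ⬝ᵥ M *ᵥ z + ε * (z ⬝ᵥ D *ᵥ z) := by
    refine (isCompact_sphere 0 1).eventually_forall_of_forall_eventually fun z hz => ?_
    have hz0 : z ≠ 0 := by rintro rfl; simp at hz
    rcases (hquad z).lt_or_eq with hpos | hzero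
    · have hc : Continuous fun w : ℝ × (Fin n → ℝ) =>
          w.2 ⬝ᵥ M *ᵥ w.2 + w.1 * (w.2 ⬝ᵥ D *ᵥ w.2) := by fun_prop
      have hev := (hc.tendsto ((0 : ℝ), z)).eventually (p := fun y : ℝ => 0 < y)
        (lt_mem_nhds (by simpa using hpos))
      exact hev.mono fun w hw _ => hw
    · have hker : M *ᵥ z = 0 := by
        have := (hM.dotProduct_mulVec_zero_iff z).1 (by simpa using hzero.symm)
        exact this
      have hc : Continuous fun w : ℝ × (Fin n → ℝ) => w.2 ⬝ᵥ D *ᵥ w.2 := by fun_prop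
      have hev := (hc.tendsto ((0 : ℝ), z)).eventually (p := fun y : ℝ => 0 < y)
        (lt_mem_nhds (h z hz0 hker))
      exact hev.mono fun w hw hε => add_pos_of_nonneg_of_pos (hquad _) (mul_pos hε hw)
  have hpos : ∀ᶠ ε : ℝ in 𝓝[>] 0, 0 < ε := eventually_mem_nhdsWithin
  obtain ⟨ε, h1, h2⟩ := ((key.filter_mono nhdsWithin_le_nhds).and hpos).exists
  refine ⟨ε, h2, (posDef_iff_forall_mem_sphere (hMs.add (hD.smul ε))).2 fun z hz => ?_⟩
  simpa [add_mulVec, smul_mulVec, dotProduct_add] using h1 z hz h2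

theorem IsSemidefinite.smul {n : ℕ} {M : Matrix (Fin n) (Fin n) ℝ} (hM : IsSemidefinite M)
    (c : ℝ) : IsSemidefinite (c • M) := by
  rcases le_total 0 c with hc | hc
  · exact hM.imp (fun h => h.smul hc) fun h => by simpa using h.smul hc
  · have hc' : 0 ≤ -c := by linarith
    exact hM.symm.imp (fun h => by simpa using h.smul hc')
      fun h => by simpa using h.smul hc'

theorem isSemidefinite_congr_iff {n : ℕ} {P : Matrix (Fin n) (Fin n) ℝ} (hP : IsUnit P.det)
    (M : Matrix (Fin n) (Fin n) ℝ) : IsSemidefinite (Pᵀ * M * P) ↔ IsSemidefinite M := by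
  have hu : IsUnit P := (isUnit_iff_isUnit_det P).2 hP
  have h : ∀ N : Matrix (Fin n) (Fin n) ℝ, (Pᵀ * N * P).PosSemidef ↔ N.PosSemidef := fun N => by
    have := IsUnit.posSemidef_star_left_conjugate_iff (x := N) hu
    rwa [star_eq_conjTranspose, conjTranspose_eq_transpose_of_trivial] at this
  rw [IsSemidefinite, IsSemidefinite, h, ← h (-M)]
  simp

/-! ### Evaluation of pencils -/

theorem matAt_apply {m n : ℕ} (A : Fin m → Matrix (Fin n) (Fin n) ℝ) (x : Fin m → ℝ)
    (i j : Fin n) : matAt A x i j = ∑ k, x k * A k i j := by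
  simp [matAt, Matrix.sum_apply]

theorem matAt_add {m n : ℕ} (A : Fin m → Matrix (Fin n) (Fin n) ℝ) (x y : Fin m → ℝ) :
    matAt A (x + y) = matAt A x + matAt A y := by
  simp [matAt, add_smul, Finset.sum_add_distrib]

theorem matAt_smul {m n : ℕ} (A : Fin m → Matrix (Fin n) (Fin n) ℝ) (c : ℝ) (x : Fin m → ℝ) :
    matAt A (c • x) = c • matAt A x := by
  simp [matAt, mul_smul, Finset.smul_sum]

theorem matAt_neg {m n : ℕ} (A : Fin m → Matrix (Fin n) (Fin n) ℝ) (x : Fin m → ℝ) :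
    matAt A (-x) = -matAt A x := by
  simpa using matAt_smul A (-1) x

theorem isSymm_matAt {m n : ℕ} {A : Fin m → Matrix (Fin n) (Fin n) ℝ} (hA : ∀ i, (A i).IsSymm)
    (x : Fin m → ℝ) : (matAt A x).IsSymm := by
  rw [IsSymm, matAt, transpose_sum]
  exact Finset.sum_congr rfl fun i _ => by rw [transpose_smul, (hA i).eq]

theorem continuous_matAt {m n : ℕ} (A : Fin m → Matrix (Fin n) (Fin n) ℝ) :
    Continuous (matAt A) := by
  unfold matAt
  fun_prop

theorem eval_detForm {m n : ℕ} (A : Fin m → Matrix (Fin n) (Fin n) ℝ) (x : Fin m → ℝ) :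
    MvPolynomial.eval x (detForm A) = (matAt A x).det := by
  rw [detForm, RingHom.map_det]
  congr 1
  ext i j
  simp [matAt, Matrix.sum_apply]

theorem matAt_congr {m n : ℕ} (A : Fin m → Matrix (Fin n) (Fin n) ℝ)
    (P : Matrix (Fin n) (Fin n) ℝ) (x : Fin m → ℝ) :
    matAt (fun i => Pᵀ * A i * P) x = Pᵀ * matAt A x * P := by
  simp [matAt, Finset.mul_sum, Finset.sum_mul]

theorem matAt_inCoords (A : Fin 4 → Matrix (Fin 4) (Fin 4) ℝ)
    (T : (Fin 4 → ℝ) ≃ₗ[ℝ] (Fin 4 → ℝ)) (x : Fin 4 → ℝ) :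
    matAt (inCoords A T) x = matAt A (T x) := by
  have h : ∀ y, matAt A y = Fintype.linearCombination ℝ A y := fun y => by
    simp [matAt, Fintype.linearCombination_apply]
  have hx : x = ∑ i, x i • Pi.single i (1 : ℝ) := by
    ext j; simp [Finset.sum_apply, Pi.single_apply]
  conv_rhs => rw [hx]
  rw [h (T _), map_sum, map_sum]
  simp [matAt, inCoords, ← h, Finset.smul_sum, smul_smul]

theorem matAt_cons {n : ℕ} (B : Fin 4 → Matrix (Fin n) (Fin n) ℝ) (t : ℝ) (y : Fin 3 → ℝ) :
    matAt B (Fin.cons t y : Fin 4 → ℝ) = t • B 0 + matAt (fun j : Fin 3 => B j.succ) y := by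
  simp [matAt, Fin.sum_univ_succ]

theorem matAt_submatrix {m n k : ℕ} (A : Fin m → Matrix (Fin n) (Fin n) ℝ) (e : Fin k → Fin n)
    (y : Fin m → ℝ) :
    matAt (fun j => (A j).submatrix e e) y = (matAt A y).submatrix e e := by
  ext i j
  simp [matAt_apply]

theorem mk_mem_spectrahedron_iff (A : Fin 4 → Matrix (Fin 4) (Fin 4) ℝ) (x : Fin 4 → ℝ)
    (hx : x ≠ 0) :
    Projectivization.mk ℝ x hx ∈ spectrahedron A ↔ IsSemidefinite (matAt A x) := by
  obtain ⟨c, hc⟩ := Projectivization.exists_smul_eq_mk_rep ℝ x hx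
  have hc' : matAt A (Projectivization.mk ℝ x hx).rep = (c : ℝ) • matAt A x := by
    rw [← hc, ← matAt_smul]; rfl
  rw [spectrahedron, Set.mem_ofPred_eq, hc']
  refine ⟨fun h => ?_, fun h => h.smul _⟩
  simpa [smul_smul] using h.smul (c : ℝ)⁻¹

/-! ### Interlacing roots of a quadratic and a cubic -/

theorem exists_roots_quadratic {a b c t₀ : ℝ} (ha : 0 < a)
    (h : a * t₀ ^ 2 + b * t₀ + c ≤ 0) :
    ∃ r s : ℝ, r ≤ t₀ ∧ t₀ ≤ s ∧ ∀ t, a * t ^ 2 + b * t + c = a * ((t - r) * (t - s)) := by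
  have hD : 0 ≤ b ^ 2 - 4 * a * c := by nlinarith [sq_nonneg (2 * a * t₀ + b)]
  obtain ⟨d, hd, hd2⟩ : ∃ d : ℝ, 0 ≤ d ∧ d ^ 2 = b ^ 2 - 4 * a * c :=
    ⟨_, Real.sqrt_nonneg _, Real.sq_sqrt hD⟩
  have hle : (2 * a * t₀ + b) ^ 2 ≤ d ^ 2 := by nlinarith
  have habs := abs_le_of_sq_le_sq' hle hd
  refine ⟨(-b - d) / (2 * a), (-b + d) / (2 * a), ?_, ?_, fun t => ?_⟩
  · rw [div_le_iff₀ (by positivity)]; nlinarith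
  · rw [le_div_iff₀ (by positivity)]; nlinarith
  · have hc : c = (b ^ 2 - d ^ 2) / (4 * a) := by rw [hd2]; field_simp; ring
    rw [hc]; field_simp; ring

/-- A real cubic with positive leading coefficient that is nonnegative at `r` and nonpositive at
`s ≥ r` has three real roots, separated by `r` and `s`. If `r = s`, the sign condition has to be
replaced by its infinitesimal version. -/
theorem exists_interlacing_roots_cubic {a b c d r s : ℝ} (ha : 0 < a) (hrs : r ≤ s)
    (hr : 0 ≤ a * r ^ 3 + b * r ^ 2 + c * r + d) (hs : a * s ^ 3 + b * s ^ 2 + c * s + d ≤ 0)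
    (hder : r = s → 3 * a * r ^ 2 + 2 * b * r + c ≤ 0) :
    ∃ α₀ α₁ α₂ : ℝ, α₀ ≤ r ∧ r ≤ α₁ ∧ α₁ ≤ s ∧ s ≤ α₂ ∧
      ∀ t, a * t ^ 3 + b * t ^ 2 + c * t + d = a * ((t - α₀) * (t - α₁) * (t - α₂)) := by
  -- Splitting off a root `m` leaves the quadratic with these coefficients.
  have split : ∀ m, a * m ^ 3 + b * m ^ 2 + c * m + d = 0 → ∀ t,
      a * t ^ 3 + b * t ^ 2 + c * t + d =
        (t - m) * (a * t ^ 2 + (b + a * m) * t + (c + b * m + a * m ^ 2)) := fun m hm t => by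
    linear_combination hm
  rcases hrs.eq_or_lt with rfl | hlt
  · have h0 := le_antisymm hs hr
    obtain ⟨u, v, hu, hv, huv⟩ := exists_roots_quadratic (t₀ := r) (b := b + a * r)
      (c := c + b * r + a * r ^ 2) ha (by nlinarith [hder rfl])
    exact ⟨u, r, v, hu, le_rfl, le_rfl, hv, fun t => by rw [split r h0, huv]; ring⟩
  rcases hr.eq_or_lt with h0 | hr
  · have hq := split r h0.symm s
    obtain ⟨u, v, hu, hv, huv⟩ := exists_roots_quadratic (t₀ := s) (b := b + a * r)
      (c := c + b * r + a * r ^ 2) ha (by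
        rw [hq] at hs; exact nonpos_of_mul_nonpos_right hs (by linarith))
    rcases le_total r u with h | h
    · exact ⟨r, u, v, le_rfl, h, hu, hv, fun t => by rw [split r h0.symm, huv]; ring⟩
    · exact ⟨u, r, v, h, le_rfl, hrs, hv, fun t => by rw [split r h0.symm, huv]; ring⟩
  · obtain ⟨m, ⟨hm1, hm2⟩, hm⟩ : ∃ m ∈ Set.Icc r s, a * m ^ 3 + b * m ^ 2 + c * m + d = 0 :=
      intermediate_value_Icc' hrs (by fun_prop) ⟨hs, hr.le⟩
    have hrm : r < m := hm1.lt_of_ne (by rintro rfl; exact hr.ne' hm)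
    have hqr : a * r ^ 2 + (b + a * m) * r + (c + b * m + a * m ^ 2) ≤ 0 := by
      rw [split m hm r] at hr
      by_contra hcon
      push Not at hcon
      nlinarith [mul_pos (sub_pos.2 hrm) hcon]
    obtain ⟨u, v, hu, hv, huv⟩ := exists_roots_quadratic ha hqr
    rcases le_total s v with h | h
    · exact ⟨u, m, v, hu, hm1, hm2, h, fun t => by rw [split m hm, huv]; ring⟩
    · -- Then `v ≤ s`, and `s` cannot exceed both `m` and `v`, as the cubic is `≤ 0` at `s`.
      have hs' : s = m ∨ s = v := by
        by_contra! hcon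
        rw [split m hm, huv] at hs
        have h1 : 0 < s - m := sub_pos.2 (hm2.lt_of_ne hcon.1.symm)
        have h2 : 0 < s - v := sub_pos.2 (h.lt_of_ne hcon.2.symm)
        have h3 : 0 < s - u := by linarith
        exact absurd hs (not_le.2 (by positivity))
      rcases hs' with rfl | rfl
      · exact ⟨u, v, s, hu, hv, h, le_rfl, fun t => by rw [split s hm, huv]; ring⟩
      · exact ⟨u, m, s, hu, hm1, hm2, le_rfl, fun t => by rw [split m hm, huv]; ring⟩

/-- The quadratic form of the adjugate of a semidefinite `2 × 2` matrix `(p, q; q, r)` of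
determinant zero has the sign of the matrix. -/
theorem adjugate_form_nonneg {p q r : ℝ} (hp : 0 ≤ p) (hr : 0 ≤ r) (h : p * r - q ^ 2 = 0)
    (l k : ℝ) : 0 ≤ l ^ 2 * r - 2 * l * k * q + k ^ 2 * p := by
  rcases hp.eq_or_lt with rfl | hp
  · have hq : q = 0 := by simpa using h
    subst hq; nlinarith [mul_nonneg (sq_nonneg l) hr]
  · have : p * (l ^ 2 * r - 2 * l * k * q + k ^ 2 * p) = (k * p - l * q) ^ 2 := by
      linear_combination l ^ 2 * h
    exact nonneg_of_mul_nonneg_right (this ▸ sq_nonneg _) hp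

/-- Cauchy interlacing for a pencil of symmetric `3 × 3` matrices `(m, l, k; l, p, q; k, q, r)`
that contains a positive definite matrix, and the minor with entries `p, q, r`. -/
theorem exists_interlacing_roots_of_pos {m l k p q r : ℝ} (hp : 0 < p) (hr : 0 < r)
    (hQ : 0 < p * r - q ^ 2)
    (hR : 0 < m * (p * r - q ^ 2) - (l ^ 2 * r - 2 * l * k * q + k ^ 2 * p))
    (m' l' k' p' q' r' : ℝ) :
    ∃ α₀ α₁ α₂ β₀ β₁ : ℝ, α₀ ≤ β₀ ∧ β₀ ≤ α₁ ∧ α₁ ≤ β₁ ∧ β₁ ≤ α₂ ∧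
      (∀ t, (t * p + p') * (t * r + r') - (t * q + q') ^ 2 =
        (p * r - q ^ 2) * ((t - β₀) * (t - β₁))) ∧
      ∀ t, (t * m + m') * ((t * p + p') * (t * r + r') - (t * q + q') ^ 2) -
          ((t * l + l') ^ 2 * (t * r + r') - 2 * (t * l + l') * (t * k + k') * (t * q + q') +
            (t * k + k') ^ 2 * (t * p + p')) =
        (m * (p * r - q ^ 2) - (l ^ 2 * r - 2 * l * k * q + k ^ 2 * p)) *
          ((t - α₀) * (t - α₁) * (t - α₂)) := by
  -- The quadratic is nonpositive at the zeros of both diagonal entries.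
  obtain ⟨β₀, β₁, hβ₀, hβ₁, hβ⟩ := exists_roots_quadratic (t₀ := -p' / p)
    (b := p * r' + p' * r - 2 * q * q') (c := p' * r' - q' ^ 2) hQ (by
      have : (p * r - q ^ 2) * (-p' / p) ^ 2 + (p * r' + p' * r - 2 * q * q') * (-p' / p) +
          (p' * r' - q' ^ 2) = -((-p' / p) * q + q') ^ 2 := by field_simp; ring
      rw [this]; exact neg_nonpos.2 (sq_nonneg _))
  have hQt : ∀ t, (t * p + p') * (t * r + r') - (t * q + q') ^ 2 =
        (p * r - q ^ 2) * ((t - β₀) * (t - β₁)) := fun t => by rw [← hβ]; ring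
  have hβr : β₀ ≤ -r' / r ∧ -r' / r ≤ β₁ := by
    have h1 : (p * r - q ^ 2) * ((-r' / r - β₀) * (-r' / r - β₁)) ≤ 0 := by
      rw [← hQt]
      have : -r' / r * r + r' = 0 := by field_simp; ring
      rw [this]; nlinarith [sq_nonneg (-r' / r * q + q')]
    have h2 := nonpos_of_mul_nonpos_right h1 hQ
    have h3 : β₀ ≤ β₁ := hβ₀.trans hβ₁
    constructor
    · by_contra! hcon; nlinarith
    · by_contra! hcon; nlinarith
  have hneg : ∀ {u u' : ℝ}, 0 < u → ∀ {t}, t ≤ -u' / u → t * u + u' ≤ 0 := fun hu t ht => by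
    rw [le_div_iff₀ hu] at ht; linarith
  have hpos : ∀ {u u' : ℝ}, 0 < u → ∀ {t}, -u' / u ≤ t → 0 ≤ t * u + u' := fun hu t ht => by
    rw [div_le_iff₀ hu] at ht; linarith
  have hz₀ := hQt β₀
  have hz₁ := hQt β₁
  rw [sub_self, zero_mul, mul_zero] at hz₀
  rw [sub_self, mul_zero, mul_zero] at hz₁
  obtain ⟨b, hb⟩ : ∃ b, b = m' * (p * r - q ^ 2) + m * (p * r' + p' * r - 2 * q * q') -
      (l ^ 2 * r' + 2 * l * l' * r - 2 * (l * k * q' + l * k' * q + l' * k * q) +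
        k ^ 2 * p' + 2 * k * k' * p) := ⟨_, rfl⟩
  obtain ⟨c, hc⟩ : ∃ c, c = m' * (p * r' + p' * r - 2 * q * q') + m * (p' * r' - q' ^ 2) -
      (l' ^ 2 * r + 2 * l * l' * r' - 2 * (l * k' * q' + l' * k' * q + l' * k * q') +
        k' ^ 2 * p + 2 * k * k' * p') := ⟨_, rfl⟩
  have hRt : ∀ t, (m * (p * r - q ^ 2) - (l ^ 2 * r - 2 * l * k * q + k ^ 2 * p)) * t ^ 3 +
      b * t ^ 2 + c * t +
        (m' * (p' * r' - q' ^ 2) - (l' ^ 2 * r' - 2 * l' * k' * q' + k' ^ 2 * p')) =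
      (t * m + m') * ((t * p + p') * (t * r + r') - (t * q + q') ^ 2) -
          ((t * l + l') ^ 2 * (t * r + r') - 2 * (t * l + l') * (t * k + k') * (t * q + q') +
            (t * k + k') ^ 2 * (t * p + p')) := fun t => by rw [hb, hc]; ring
  obtain ⟨α₀, α₁, α₂, h1, h2, h3, h4, h5⟩ := exists_interlacing_roots_cubic (r := β₀) (s := β₁)
    (b := b) (c := c) (d := m' * (p' * r' - q' ^ 2) -
      (l' ^ 2 * r' - 2 * l' * k' * q' + k' ^ 2 * p')) hR (hβ₀.trans hβ₁)
    (by
      rw [hRt, hz₀, mul_zero, zero_sub]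
      have := adjugate_form_nonneg (p := -(β₀ * p + p')) (q := -(β₀ * q + q'))
        (r := -(β₀ * r + r')) (by linarith [hneg hp hβ₀]) (by linarith [hneg hr hβr.1])
        (by linarith) (β₀ * l + l') (β₀ * k + k')
      linarith)
    (by
      rw [hRt, hz₁, mul_zero, zero_sub]
      have := adjugate_form_nonneg (hpos hp hβ₁) (hpos hr hβr.2) hz₁ (β₁ * l + l') (β₁ * k + k')
      linarith)
    (by
      -- If the roots coincide, then the `2 × 2` block vanishes there.
      intro heq
      subst heq
      have hp0 : p' = -(β₀ * p) := by linarith [hneg hp hβ₀, hpos hp hβ₁]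
      have hr0 : r' = -(β₀ * r) := by linarith [hneg hr hβr.1, hpos hr hβr.2]
      have hq0 : q' = -(β₀ * q) := by
        rw [hp0] at hz₀
        have : (β₀ * q + q') ^ 2 = 0 := by linarith
        linarith [pow_eq_zero_iff (two_ne_zero) |>.1 this]
      subst hp0 hr0 hq0
      have h0 : 0 ≤ (β₀ * l + l') ^ 2 * r - 2 * (β₀ * l + l') * (β₀ * k + k') * q +
          (β₀ * k + k') ^ 2 * p := by
        have : p * ((β₀ * l + l') ^ 2 * r - 2 * (β₀ * l + l') * (β₀ * k + k') * q +
          (β₀ * k + k') ^ 2 * p) = (β₀ * l + l') ^ 2 * (p * r - q ^ 2) +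
            ((β₀ * k + k') * p - (β₀ * l + l') * q) ^ 2 := by ring
        exact nonneg_of_mul_nonneg_right (this ▸ by positivity) hp
      rw [hb, hc]
      linarith)
  exact ⟨α₀, α₁, α₂, β₀, β₁, h1, h2, h3, h4, hQt, fun t => by rw [← hRt, h5]⟩

/-! ### Definite pencils of symmetric `3 × 3` matrices -/

/-- The lower right principal `2 × 2` minor of a symmetric `3 × 3` matrix. -/
def lowerMinor (M : Matrix (Fin 3) (Fin 3) ℝ) : ℝ :=
  M 1 1 * M 2 2 - M 1 2 ^ 2

theorem det_eq_of_isSymm {M : Matrix (Fin 3) (Fin 3) ℝ} (hM : M.IsSymm) :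
    M.det = M 0 0 * (M 1 1 * M 2 2 - M 1 2 ^ 2) -
      (M 0 1 ^ 2 * M 2 2 - 2 * M 0 1 * M 0 2 * M 1 2 + M 0 2 ^ 2 * M 1 1) := by
  rw [det_fin_three, hM.apply 0 1, hM.apply 0 2, hM.apply 1 2]
  ring

theorem lowerMinor_pos {M : Matrix (Fin 3) (Fin 3) ℝ} (hM : M.PosDef) : 0 < lowerMinor M := by
  have h := (hM.submatrix (e := Fin.succ) (Fin.succ_injective 2)).det_pos
  have hs : M.IsSymm := (conjTranspose_eq_transpose_of_trivial M).symm.trans hM.1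
  rw [det_fin_two] at h
  have h' := hs.apply 1 2
  simp only [submatrix_apply, Fin.succ_zero_eq_one, Fin.succ_one_eq_two] at h
  rw [lowerMinor]
  rw [h'] at h
  linarith

/-- The determinant of a pencil of symmetric `3 × 3` matrices is interlaced by a principal minor
with respect to each point at which the pencil is definite. The forms need to be known only up to
constants. -/
theorem interlaces_of_posDef {L : Fin 3 → Matrix (Fin 3) (Fin 3) ℝ} (hL : ∀ i, (L i).IsSymm)
    {h f : MvPolynomial (Fin 3) ℝ} {c d : ℝ} (hc : c ≠ 0) (hd : d ≠ 0)
    (hf : ∀ y, MvPolynomial.eval y f = c * (matAt L y).det)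
    (hh : ∀ y, MvPolynomial.eval y h = d * lowerMinor (matAt L y))
    {e : Fin 3 → ℝ} (he : (matAt L e).PosDef) : Interlaces 2 h f e := by
  have hs := isSymm_matAt hL
  have hdet := he.det_pos
  have hQ := lowerMinor_pos he
  refine ⟨?_, ?_, fun x => ?_⟩
  · rw [hf]; exact mul_ne_zero hc hdet.ne'
  · rw [hh]; exact mul_ne_zero hd hQ.ne'
  rw [det_eq_of_isSymm (hs e)] at hdet
  obtain ⟨α₀, α₁, α₂, β₀, β₁, h1, h2, h3, h4, h5, h6⟩ :=
    exists_interlacing_roots_of_pos (he.diag_pos (i := 1)) (he.diag_pos (i := 2)) hQ hdet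
      (matAt L x 0 0) (matAt L x 0 1) (matAt L x 0 2) (matAt L x 1 1) (matAt L x 1 2)
      (matAt L x 2 2)
  refine ⟨![α₀, α₁, α₂], ![β₀, β₁], fun t => ?_, fun t => ?_, fun i => ?_⟩
  · have := h6 t
    rw [hf, hf, det_eq_of_isSymm (hs _), det_eq_of_isSymm (hs _), matAt_add, matAt_smul]
    simp only [Fin.prod_univ_succ, Matrix.add_apply, Matrix.smul_apply, smul_eq_mul]
    rw [this]
    simp
    ring
  · have := h5 t
    rw [hh, hh, matAt_add, matAt_smul]
    simp only [lowerMinor, Fin.prod_univ_succ, Matrix.add_apply, Matrix.smul_apply, smul_eq_mul]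
    rw [this]
    simp
    ring
  · fin_cases i
    · exact ⟨h1, h2⟩
    · exact ⟨h3, h4⟩

/-! ### Definiteness from interlacing -/

/-- If the lower minor of a pencil is a nondegenerate quadratic form that is hyperbolic with
respect to `e`, then it is positive at `e`: its signature is `(1, 2)`. -/
theorem lowerMinor_pos_of_interlaces {L : Fin 3 → Matrix (Fin 3) (Fin 3) ℝ}
    (hsurj : ∀ a b c : ℝ, ∃ y, matAt L y 1 1 = a ∧ matAt L y 1 2 = b ∧ matAt L y 2 2 = c)
    {h f : MvPolynomial (Fin 3) ℝ} {d : ℝ} (hd : d ≠ 0)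
    (hh : ∀ y, MvPolynomial.eval y h = d * lowerMinor (matAt L y))
    {e : Fin 3 → ℝ} (he : Interlaces 2 h f e) : 0 < lowerMinor (matAt L e) := by
  obtain ⟨-, hne, hroots⟩ := he
  rw [hh] at hne
  by_contra hcon
  have hneg : lowerMinor (matAt L e) < 0 :=
    lt_of_le_of_ne (not_lt.1 hcon) (right_ne_zero_of_mul hne)
  -- A direction orthogonal to `e` in which the form is negative.
  obtain ⟨x, horth, hx⟩ : ∃ x, matAt L e 1 1 * matAt L x 2 2 + matAt L x 1 1 * matAt L e 2 2 -
      2 * matAt L e 1 2 * matAt L x 1 2 = 0 ∧ lowerMinor (matAt L x) < 0 := by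
    by_cases h1 : matAt L e 1 1 = 0
    · by_cases h2 : matAt L e 2 2 = 0
      · obtain ⟨x, hx1, hx2, hx3⟩ := hsurj 1 0 (-1)
        refine ⟨x, by simp [h1, h2, hx2], by norm_num [lowerMinor, hx1, hx2, hx3]⟩
      · obtain ⟨x, hx1, hx2, hx3⟩ := hsurj (2 * matAt L e 1 2) (matAt L e 2 2) 0
        refine ⟨x, by rw [hx1, hx2, hx3]; ring, ?_⟩
        have : 0 < matAt L e 2 2 ^ 2 := by positivity
        simp only [lowerMinor, hx1, hx2, hx3]
        linarith
    · obtain ⟨x, hx1, hx2, hx3⟩ := hsurj 0 (matAt L e 1 1) (2 * matAt L e 1 2)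
      refine ⟨x, by rw [hx1, hx2, hx3]; ring, ?_⟩
      have : 0 < matAt L e 1 1 ^ 2 := by positivity
      simp only [lowerMinor, hx1, hx2, hx3]
      linarith
  obtain ⟨α, β, -, hβ, -⟩ := hroots x
  have h0 := hβ (β 0)
  rw [Fin.prod_univ_two, sub_self, zero_mul, mul_zero, hh] at h0
  have h1 := (mul_eq_zero.1 h0).resolve_left hd
  rw [matAt_add, matAt_smul] at h1
  simp only [lowerMinor, Matrix.add_apply, Matrix.smul_apply, smul_eq_mul] at h1 hneg hx
  have h2 : β 0 ^ 2 * (matAt L e 1 1 * matAt L e 2 2 - matAt L e 1 2 ^ 2) +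
      (matAt L x 1 1 * matAt L x 2 2 - matAt L x 1 2 ^ 2) = 0 := by
    linear_combination h1 - β 0 * horth
  nlinarith [mul_nonneg (sq_nonneg (β 0)) (neg_nonneg.2 hneg.le)]

/-- If the lower minor interlaces the determinant with respect to `e` and the definiteness of the
pencil at `e` fails only by the sign of the determinant, then the determinant vanishes on the whole
conic of the lower minor. At a point of the conic where the lower block is `w wᵀ`, the determinant
is `-(l₁ w₂ - l₂ w₁)²`. -/
theorem det_vanishes_on_conic {L : Fin 3 → Matrix (Fin 3) (Fin 3) ℝ} (hL : ∀ i, (L i).IsSymm)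
    {h f : MvPolynomial (Fin 3) ℝ} {c d : ℝ} (hc : c ≠ 0) (hd : d ≠ 0)
    (hf : ∀ y, MvPolynomial.eval y f = c * (matAt L y).det)
    (hh : ∀ y, MvPolynomial.eval y h = d * lowerMinor (matAt L y))
    {e : Fin 3 → ℝ} (he : Interlaces 2 h f e) (hQ : 0 < lowerMinor (matAt L e))
    (he1 : 0 < matAt L e 1 1) (hR : (matAt L e).det < 0) {y : Fin 3 → ℝ} {w₁ w₂ : ℝ}
    (h11 : matAt L y 1 1 = w₁ ^ 2) (h12 : matAt L y 1 2 = w₁ * w₂)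
    (h22 : matAt L y 2 2 = w₂ ^ 2) : matAt L y 0 1 * w₂ - matAt L y 0 2 * w₁ = 0 := by
  have hs := isSymm_matAt hL
  obtain ⟨-, -, hroots⟩ := he
  by_cases hw : w₁ = 0 ∧ w₂ = 0
  · simp [hw.1, hw.2]
  obtain ⟨α, β, hα, hβ, hαβ⟩ := hroots (-y)
  have hβt : ∀ t, lowerMinor (matAt L (t • e + -y)) =
      lowerMinor (matAt L e) * ((t - β 0) * (t - β 1)) := fun t => by
    have := hβ t
    rw [hh, hh, mul_assoc, Fin.prod_univ_two] at this
    exact mul_left_cancel₀ hd this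
  have hα0 : (matAt L (-y)).det = (matAt L e).det * -(α 0 * α 1 * α 2) := by
    have := hα 0
    rw [zero_smul, zero_add, hf, hf, mul_assoc, Fin.prod_univ_three] at this
    rw [mul_left_cancel₀ hc this]
    ring
  have hκ : 0 < matAt L e 1 1 * w₂ ^ 2 + matAt L e 2 2 * w₁ ^ 2 -
      2 * matAt L e 1 2 * (w₁ * w₂) := by
    have h1 : matAt L e 1 1 * (matAt L e 1 1 * w₂ ^ 2 + matAt L e 2 2 * w₁ ^ 2 -
        2 * matAt L e 1 2 * (w₁ * w₂)) =
        (matAt L e 1 1 * w₂ - matAt L e 1 2 * w₁) ^ 2 + lowerMinor (matAt L e) * w₁ ^ 2 := by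
      rw [lowerMinor]; ring
    refine pos_of_mul_pos_right (h1 ▸ ?_) he1.le
    by_cases hw1 : w₁ = 0
    · have : w₂ ≠ 0 := fun h => hw ⟨hw1, h⟩
      subst hw1
      have := he1.ne'
      simp only [mul_zero, sub_zero]
      positivity
    · positivity
  have e0 := hβt 0
  have e1 := hβt 1
  simp only [matAt_add, matAt_smul, matAt_neg, lowerMinor, Matrix.add_apply, Matrix.smul_apply,
    Matrix.neg_apply, smul_eq_mul, h11, h12, h22] at e0 e1
  rw [lowerMinor] at hQ
  have hprod : β 0 * β 1 = 0 := by
    have : (matAt L e 1 1 * matAt L e 2 2 - matAt L e 1 2 ^ 2) * (β 0 * β 1) = 0 := by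
      linear_combination -e0
    exact (mul_eq_zero.1 this).resolve_left hQ.ne'
  have hsum : 0 < β 0 + β 1 := by
    have : (matAt L e 1 1 * matAt L e 2 2 - matAt L e 1 2 ^ 2) * (β 0 + β 1) =
        matAt L e 1 1 * w₂ ^ 2 + matAt L e 2 2 * w₁ ^ 2 - 2 * matAt L e 1 2 * (w₁ * w₂) := by
      linear_combination e1 - e0
    exact pos_of_mul_pos_right (this ▸ hκ) hQ.le
  obtain ⟨i1, i2⟩ := hαβ 0
  obtain ⟨i3, i4⟩ := hαβ 1
  change α 0 ≤ β 0 at i1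
  change β 0 ≤ α 1 at i2
  change α 1 ≤ β 1 at i3
  change β 1 ≤ α 2 at i4
  have hβ0 : β 0 = 0 := by
    rcases mul_eq_zero.1 hprod with h0 | h0
    · exact h0
    · linarith
  have hα012 : α 0 * α 1 * α 2 ≤ 0 := by
    rw [hβ0] at i1 i2
    have : 0 ≤ α 1 * α 2 := mul_nonneg i2 (by linarith)
    nlinarith
  have hle : (matAt L (-y)).det ≤ 0 := by rw [hα0]; nlinarith
  rw [det_eq_of_isSymm (hs _), matAt_neg] at hle
  simp only [Matrix.neg_apply, h11, h12, h22] at hle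
  have : (matAt L y 0 1 * w₂ - matAt L y 0 2 * w₁) ^ 2 ≤ 0 := by linarith
  exact pow_eq_zero_iff (two_ne_zero) |>.1 (le_antisymm this (sq_nonneg _))

/-- Interlacing by the lower minor forces the pencil to be definite at `e`, in the form of
Sylvester's criterion, unless the determinant vanishes on the conic of the lower minor. -/
theorem definite_of_interlaces {L : Fin 3 → Matrix (Fin 3) (Fin 3) ℝ} (hL : ∀ i, (L i).IsSymm)
    (hsurj : ∀ a b c : ℝ, ∃ y, matAt L y 1 1 = a ∧ matAt L y 1 2 = b ∧ matAt L y 2 2 = c)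
    (hconic : ¬ ∀ (y : Fin 3 → ℝ) (w₁ w₂ : ℝ), matAt L y 1 1 = w₁ ^ 2 →
      matAt L y 1 2 = w₁ * w₂ → matAt L y 2 2 = w₂ ^ 2 →
      matAt L y 0 1 * w₂ - matAt L y 0 2 * w₁ = 0)
    {h f : MvPolynomial (Fin 3) ℝ} {c d : ℝ} (hc : c ≠ 0) (hd : d ≠ 0)
    (hf : ∀ y, MvPolynomial.eval y f = c * (matAt L y).det)
    (hh : ∀ y, MvPolynomial.eval y h = d * lowerMinor (matAt L y))
    {e : Fin 3 → ℝ} (he : Interlaces 2 h f e) :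
    0 < lowerMinor (matAt L e) ∧ 0 < matAt L e 1 1 * (matAt L e).det := by
  have hQ := lowerMinor_pos_of_interlaces hsurj hd hh he
  refine ⟨hQ, ?_⟩
  have h1 : matAt L e 1 1 ≠ 0 := by
    intro h0
    rw [lowerMinor, h0] at hQ
    nlinarith [sq_nonneg (matAt L e 1 2)]
  have h2 : (matAt L e).det ≠ 0 := by
    have := he.1
    rw [hf] at this
    exact right_ne_zero_of_mul this
  by_contra hcon
  refine hconic fun y w₁ w₂ h11 h12 h22 => ?_
  rcases h1.lt_or_gt with hneg | hpos
  · have hR : 0 < (matAt L e).det := by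
      by_contra hn
      exact hcon (mul_pos_of_neg_of_neg hneg (lt_of_le_of_ne (not_lt.1 hn) h2))
    have hmat : ∀ x, matAt (fun i => -L i) x = -matAt L x := fun x => by simp [matAt]
    have hdet : ∀ x, (matAt (fun i => -L i) x).det = -(matAt L x).det := fun x => by
      rw [hmat, det_neg]; simp; norm_num
    have hmin : ∀ x, lowerMinor (matAt (fun i => -L i) x) = lowerMinor (matAt L x) := fun x => by
      rw [hmat]; simp [lowerMinor]
    have := det_vanishes_on_conic (L := fun i => -L i) (fun i => (hL i).neg) (neg_ne_zero.2 hc) hd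
      (fun y => by rw [hf, hdet]; ring) (fun y => by rw [hh, hmin]) he (by rwa [hmin])
      (by rw [hmat]; simpa using hneg) (by rw [hdet]; linarith) (y := -y) (w₁ := w₁) (w₂ := w₂)
      (by simpa [hmat, matAt_neg] using h11) (by simpa [hmat, matAt_neg] using h12)
      (by simpa [hmat, matAt_neg] using h22)
    simpa [hmat, matAt_neg] using this
  · have hR : (matAt L e).det < 0 := by
      by_contra hn
      exact hcon (mul_pos hpos (lt_of_le_of_ne (not_lt.1 hn) h2.symm))
    exact det_vanishes_on_conic hL hc hd hf hh he hQ hpos hR h11 h12 h22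

/-! ### Lines through the node -/

/-- A point of the tangent conic whose kernel vector is also orthogonal to the linear forms in
another row: a binary form of odd degree on the conic has a real zero. -/
theorem exists_point_on_conic {M : Fin 3 → Matrix (Fin 4) (Fin 4) ℝ}
    (hsurj : ∀ a b c : ℝ, ∃ y, matAt M y 2 2 = a ∧ matAt M y 2 3 = b ∧ matAt M y 3 3 = c)
    (j : Fin 4) : ∃ (y : Fin 3 → ℝ) (w₁ w₂ : ℝ), ¬ (w₁ = 0 ∧ w₂ = 0) ∧
      matAt M y 2 2 = w₁ ^ 2 ∧ matAt M y 2 3 = w₁ * w₂ ∧ matAt M y 3 3 = w₂ ^ 2 ∧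
      matAt M y j 2 * w₂ - matAt M y j 3 * w₁ = 0 := by
  obtain ⟨y₁, a1, a2, a3⟩ := hsurj 1 0 0
  obtain ⟨y₂, b1, b2, b3⟩ := hsurj 0 1 0
  obtain ⟨y₃, c1, c2, c3⟩ := hsurj 0 0 1
  let y : ℝ → Fin 3 → ℝ := fun θ =>
    (Real.cos θ ^ 2) • y₁ + (Real.cos θ * Real.sin θ) • y₂ + (Real.sin θ ^ 2) • y₃
  have hy : ∀ θ a b, matAt M (y θ) a b = Real.cos θ ^ 2 * matAt M y₁ a b +
      Real.cos θ * Real.sin θ * matAt M y₂ a b + Real.sin θ ^ 2 * matAt M y₃ a b := by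
    intro θ a b
    simp [y, matAt_add, matAt_smul]
  let φ : ℝ → ℝ := fun θ =>
    matAt M (y θ) j 2 * Real.sin θ - matAt M (y θ) j 3 * Real.cos θ
  have hφ : Continuous φ := by simp only [φ, hy]; fun_prop
  have hodd : φ Real.pi = -φ 0 := by simp [φ, hy]
  obtain ⟨θ, hθ⟩ : ∃ θ, φ θ = 0 := by
    refine mem_range_of_exists_le_of_exists_ge hφ ?_ ?_
    · rcases le_total (φ 0) 0 with h | h
      · exact ⟨0, h⟩
      · exact ⟨Real.pi, by linarith⟩
    · rcases le_total 0 (φ 0) with h | h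
      · exact ⟨0, h⟩
      · exact ⟨Real.pi, by linarith⟩
  refine ⟨y θ, Real.cos θ, Real.sin θ, fun h => ?_, ?_, ?_, ?_, hθ⟩
  · have := Real.sin_sq_add_cos_sq θ
    rw [h.1, h.2] at this
    norm_num at this
  · rw [hy, a1, b1, c1]; ring
  · rw [hy, a2, b2, c2]; ring
  · rw [hy, a3, b3, c3]; ring

/-- If the matrices of two real points have a common kernel vector, then the surface contains the
line through the points. -/
theorem containsLineThrough_of_common_kernel {A : Fin 4 → Matrix (Fin 4) (Fin 4) ℝ}
    {p v : Fin 4 → ℝ} (hpv : LinearIndependent ℝ ![p, v]) {z : Fin 4 → ℝ} (hz : z ≠ 0)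
    (hp : matAt A p *ᵥ z = 0) (hv : matAt A v *ᵥ z = 0) :
    ContainsLineThrough (detForm A) p := by
  refine ⟨fun i => (v i : ℂ), ?_, fun s t => ?_⟩
  · rw [LinearIndependent.pair_iff] at hpv ⊢
    intro s t hst
    have hre := hpv s.re t.re (by
      ext i; simpa using congrArg Complex.re (congrFun hst i))
    have him := hpv s.im t.im (by
      ext i; simpa using congrArg Complex.im (congrFun hst i))
    exact ⟨Complex.ext hre.1 him.1, Complex.ext hre.2 him.2⟩
  · set x : Fin 4 → ℂ := s • (fun i => (p i : ℂ)) + t • fun i => (v i : ℂ) with hx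
    have hdet : MvPolynomial.aeval x (detForm A) =
        (∑ i, x i • (A i).map (Complex.ofRealHom : ℝ →+* ℂ)).det := by
      rw [detForm, AlgHom.map_det]
      congr 1
      ext i j
      simp [Matrix.sum_apply]
    rw [hdet]
    refine exists_mulVec_eq_zero_iff.1 ⟨fun i => (z i : ℂ), fun h => hz ?_, ?_⟩
    · ext i; simpa using congrFun h i
    · ext a
      have h1 := congrFun hp a
      have h2 := congrFun hv a
      simp only [mulVec, dotProduct, matAt_apply, Pi.zero_apply] at h1 h2
      have h1' := congrArg (Complex.ofReal) h1
      have h2' := congrArg (Complex.ofReal) h2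
      push_cast at h1' h2'
      simp only [mulVec, dotProduct, Matrix.sum_apply, Matrix.smul_apply, Matrix.map_apply, hx,
        Pi.add_apply, Pi.smul_apply, smul_eq_mul, Complex.ofRealHom_eq_coe, Pi.zero_apply]
      have : ∀ b : Fin 4, (∑ k, (s * (p k : ℂ) + t * (v k : ℂ)) * (A k a b : ℂ)) * (z b : ℂ) =
          s * ((∑ k, (p k : ℂ) * (A k a b : ℂ)) * (z b : ℂ)) +
            t * ((∑ k, (v k : ℂ) * (A k a b : ℂ)) * (z b : ℂ)) := fun b => by
        simp only [Finset.sum_mul, Finset.mul_sum, ← Finset.sum_add_distrib]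
        exact Finset.sum_congr rfl fun k _ => by ring
      simp only [this, Finset.sum_add_distrib, ← Finset.mul_sum, h1', h2', mul_zero, add_zero]

/-! ### Definite completions -/

/-- A symmetric `4 × 4` matrix with one free off-diagonal entry has a positive definite completion
if the two fully specified `3 × 3` principal submatrices are positive definite. Completing squares,
the entry is chosen so that the quadratic form splits off the lower right block. -/
theorem exists_posDef_completion {M : Matrix (Fin 4) (Fin 4) ℝ} (hM : M.IsSymm)
    (h22 : 0 < M 2 2) (hQ : 0 < M 2 2 * M 3 3 - M 2 3 ^ 2)
    (h0 : 0 < (M.submatrix (Fin.succAbove 0) (Fin.succAbove 0)).det)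
    (h1 : 0 < (M.submatrix (Fin.succAbove 1) (Fin.succAbove 1)).det) :
    ∃ t : ℝ, (t • nodeNormalForm + M).PosDef := by
  rw [det_eq_of_isSymm (hM.submatrix _)] at h0 h1
  change 0 < M 1 1 * (M 2 2 * M 3 3 - M 2 3 ^ 2) -
    (M 1 2 ^ 2 * M 3 3 - 2 * M 1 2 * M 1 3 * M 2 3 + M 1 3 ^ 2 * M 2 2) at h0
  change 0 < M 0 0 * (M 2 2 * M 3 3 - M 2 3 ^ 2) -
    (M 0 2 ^ 2 * M 3 3 - 2 * M 0 2 * M 0 3 * M 2 3 + M 0 3 ^ 2 * M 2 2) at h1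
  have s10 := hM.apply 0 1
  have s20 := hM.apply 0 2
  have s30 := hM.apply 0 3
  have s21 := hM.apply 1 2
  have s31 := hM.apply 1 3
  have s32 := hM.apply 2 3
  obtain ⟨t, ht⟩ : ∃ t : ℝ, (t + M 0 1) * (M 2 2 * M 3 3 - M 2 3 ^ 2) =
      M 0 2 * M 1 2 * M 3 3 - (M 0 2 * M 1 3 + M 0 3 * M 1 2) * M 2 3 + M 0 3 * M 1 3 * M 2 2 :=
    ⟨(M 0 2 * M 1 2 * M 3 3 - (M 0 2 * M 1 3 + M 0 3 * M 1 2) * M 2 3 + M 0 3 * M 1 3 * M 2 2) /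
      (M 2 2 * M 3 3 - M 2 3 ^ 2) - M 0 1, by rw [sub_add_cancel, div_mul_cancel₀ _ hQ.ne']⟩
  have hsym : (t • nodeNormalForm + M).IsSymm := by
    refine IsSymm.add (IsSymm.smul ?_ t) hM
    ext i j
    fin_cases i <;> fin_cases j <;> rfl
  refine ⟨t, (posDef_iff_of_isSymm hsym).2 fun z hz => ?_⟩
  have hq : z ⬝ᵥ (t • nodeNormalForm + M) *ᵥ z =
      M 0 0 * z 0 ^ 2 + 2 * (t + M 0 1) * z 0 * z 1 + M 1 1 * z 1 ^ 2 +
        2 * (z 0 * M 0 2 + z 1 * M 1 2) * z 2 + 2 * (z 0 * M 0 3 + z 1 * M 1 3) * z 3 +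
        M 2 2 * z 2 ^ 2 + 2 * M 2 3 * z 2 * z 3 + M 3 3 * z 3 ^ 2 := by
    simp [dotProduct, mulVec, Fin.sum_univ_succ, nodeNormalForm, s10, s20, s30, s21, s31, s32]
    ring
  rw [hq]
  obtain ⟨Q, hQd⟩ : ∃ Q, Q = M 2 2 * M 3 3 - M 2 3 ^ 2 := ⟨_, rfl⟩
  obtain ⟨R₁, hR₁⟩ : ∃ R, R = M 1 1 * (M 2 2 * M 3 3 - M 2 3 ^ 2) -
    (M 1 2 ^ 2 * M 3 3 - 2 * M 1 2 * M 1 3 * M 2 3 + M 1 3 ^ 2 * M 2 2) := ⟨_, rfl⟩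
  obtain ⟨R₂, hR₂⟩ : ∃ R, R = M 0 0 * (M 2 2 * M 3 3 - M 2 3 ^ 2) -
    (M 0 2 ^ 2 * M 3 3 - 2 * M 0 2 * M 0 3 * M 2 3 + M 0 3 ^ 2 * M 2 2) := ⟨_, rfl⟩
  obtain ⟨l₂, hl₂⟩ : ∃ l, l = z 0 * M 0 2 + z 1 * M 1 2 := ⟨_, rfl⟩
  obtain ⟨l₃, hl₃⟩ : ∃ l, l = z 0 * M 0 3 + z 1 * M 1 3 := ⟨_, rfl⟩
  obtain ⟨w₂, hw₂⟩ : ∃ w, w = Q * z 2 + (M 3 3 * l₂ - M 2 3 * l₃) := ⟨_, rfl⟩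
  obtain ⟨w₃, hw₃⟩ : ∃ w, w = Q * z 3 + (M 2 2 * l₃ - M 2 3 * l₂) := ⟨_, rfl⟩
  rw [← hQd] at hQ
  rw [← hR₁] at h0
  rw [← hR₂] at h1
  have hid : M 2 2 * Q ^ 2 * (M 0 0 * z 0 ^ 2 + 2 * (t + M 0 1) * z 0 * z 1 + M 1 1 * z 1 ^ 2 +
        2 * (z 0 * M 0 2 + z 1 * M 1 2) * z 2 + 2 * (z 0 * M 0 3 + z 1 * M 1 3) * z 3 +
        M 2 2 * z 2 ^ 2 + 2 * M 2 3 * z 2 * z 3 + M 3 3 * z 3 ^ 2) =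
      (M 2 2 * w₂ + M 2 3 * w₃) ^ 2 + Q * w₃ ^ 2 + M 2 2 * Q * (R₂ * z 0 ^ 2 + R₁ * z 1 ^ 2) := by
    rw [hw₂, hw₃, hl₂, hl₃, hR₁, hR₂]
    rw [← hQd] at ht ⊢
    rw [show M 2 2 * Q ^ 2 * (M 0 0 * z 0 ^ 2 + 2 * (t + M 0 1) * z 0 * z 1 + M 1 1 * z 1 ^ 2 +
        2 * (z 0 * M 0 2 + z 1 * M 1 2) * z 2 + 2 * (z 0 * M 0 3 + z 1 * M 1 3) * z 3 +
        M 2 2 * z 2 ^ 2 + 2 * M 2 3 * z 2 * z 3 + M 3 3 * z 3 ^ 2) =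
      M 2 2 * Q ^ 2 * (M 0 0 * z 0 ^ 2 + M 1 1 * z 1 ^ 2 +
        2 * (z 0 * M 0 2 + z 1 * M 1 2) * z 2 + 2 * (z 0 * M 0 3 + z 1 * M 1 3) * z 3 +
        M 2 2 * z 2 ^ 2 + 2 * M 2 3 * z 2 * z 3 + M 3 3 * z 3 ^ 2) +
      2 * M 2 2 * Q * z 0 * z 1 * ((t + M 0 1) * Q) by ring, ht, hQd]
    ring
  refine pos_of_mul_pos_right (hid ▸ ?_) (by positivity : 0 ≤ M 2 2 * Q ^ 2)
  by_cases hz0 : z 0 = 0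
  · by_cases hz1 : z 1 = 0
    · by_cases hz3 : z 3 = 0
      · have hz2 : z 2 ≠ 0 := fun hz2 => hz (by
          ext i; fin_cases i <;> simp [hz0, hz1, hz2, hz3])
        simp only [hw₂, hw₃, hl₂, hl₃, hz0, hz1, hz3]
        simp
        positivity
      · simp only [hw₂, hw₃, hl₂, hl₃, hz0, hz1]
        simp
        positivity
    · positivity
  · positivity

theorem exists_posSemidef_completion {M : Fin 3 → Matrix (Fin 4) (Fin 4) ℝ}
    (hM : ∀ i, (M i).IsSymm) {e y : Fin 3 → ℝ}
    (he0 : ((matAt M e).submatrix (Fin.succAbove 0) (Fin.succAbove 0)).PosDef)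
    (he1 : ((matAt M e).submatrix (Fin.succAbove 1) (Fin.succAbove 1)).PosDef)
    (hy0 : ((matAt M y).submatrix (Fin.succAbove 0) (Fin.succAbove 0)).PosSemidef)
    (hy1 : ((matAt M y).submatrix (Fin.succAbove 1) (Fin.succAbove 1)).PosSemidef) :
    ∃ t : ℝ, (t • nodeNormalForm + matAt M y).PosSemidef := by
  have hN : nodeNormalForm.IsSymm := by
    ext i j
    fin_cases i <;> fin_cases j <;> rfl
  -- Nearby definite completions stay bounded, and have a limit.
  have hpd : ∀ s : ℝ, 0 < s → ∃ t : ℝ, (t • nodeNormalForm + matAt M (y + s • e)).PosDef := by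
    intro s hs
    have h0 : ((matAt M (y + s • e)).submatrix (Fin.succAbove 0) (Fin.succAbove 0)).PosDef := by
      rw [matAt_add, matAt_smul]
      exact PosDef.posSemidef_add hy0 (he0.smul hs)
    have h1 : ((matAt M (y + s • e)).submatrix (Fin.succAbove 1) (Fin.succAbove 1)).PosDef := by
      rw [matAt_add, matAt_smul]
      exact PosDef.posSemidef_add hy1 (he1.smul hs)
    exact exists_posDef_completion (isSymm_matAt hM _) (h0.diag_pos (i := 1)) (lowerMinor_pos h0)
      h0.det_pos h1.det_pos
  have hMc := continuous_matAt M
  let g : ℝ → ℝ := fun s => |matAt M (y + s • e) 0 0| + |matAt M (y + s • e) 1 1| +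
    |matAt M (y + s • e) 0 1|
  have hentry : ∀ i j, Continuous fun s : ℝ => matAt M (y + s • e) i j := fun i j => by
    have : Continuous fun s : ℝ => matAt M (y + s • e) := hMc.comp (by fun_prop)
    exact this.matrix_elem i j
  have hg : Continuous g := by
    exact (((hentry 0 0).abs).add ((hentry 1 1).abs)).add ((hentry 0 1).abs)
  obtain ⟨C, hC⟩ := (isCompact_Icc (a := (0 : ℝ)) (b := 1)).bddAbove_image hg.continuousOn
  have hbound : ∀ s ∈ Set.Icc (0 : ℝ) 1, ∀ t : ℝ,
      (t • nodeNormalForm + matAt M (y + s • e)).PosSemidef → t ∈ Set.Icc (-C) C := by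
    intro s hs t ht
    have hgs : g s ≤ C := hC (Set.mem_image_of_mem g hs)
    have hq := (posSemidef_iff_of_isSymm ((hN.smul t).add (isSymm_matAt hM _))).1 ht
    have hs01 := (isSymm_matAt hM (y + s • e)).apply 0 1
    have hq1 := hq ![1, 1, 0, 0]
    have hq2 := hq ![1, -1, 0, 0]
    simp only [dotProduct, mulVec, Fin.sum_univ_succ, nodeNormalForm, Matrix.add_apply,
      Matrix.smul_apply] at hq1 hq2
    simp [hs01] at hq1 hq2
    simp only [g] at hgs
    have i1 := le_abs_self (matAt M (y + s • e) 0 0)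
    have i2 := le_abs_self (matAt M (y + s • e) 1 1)
    have i3 := neg_abs_le (matAt M (y + s • e) 0 1)
    have i4 := le_abs_self (matAt M (y + s • e) 0 1)
    have i5 := abs_nonneg (matAt M (y + s • e) 0 0)
    have i6 := abs_nonneg (matAt M (y + s • e) 1 1)
    constructor <;> linarith
  let K : Set (ℝ × ℝ) := (Set.Icc 0 1 ×ˢ Set.Icc (-C) C) ∩
    {q | (q.2 • nodeNormalForm + matAt M (y + q.1 • e)).PosSemidef}
  have hK : IsCompact K := by
    refine (isCompact_Icc.prod isCompact_Icc).inter_right (isClosed_posSemidef ?_ fun q =>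
      (hN.smul _).add (isSymm_matAt hM _))
    exact (continuous_snd.smul continuous_const).add (hMc.comp (by fun_prop))
  have himg : Set.Ioc (0 : ℝ) 1 ⊆ Prod.fst '' K := by
    intro s hs
    obtain ⟨t, ht⟩ := hpd s hs.1
    exact ⟨(s, t), ⟨⟨⟨hs.1.le, hs.2⟩, hbound s ⟨hs.1.le, hs.2⟩ t ht.posSemidef⟩,
      ht.posSemidef⟩, rfl⟩
  have h0 : (0 : ℝ) ∈ Prod.fst '' K := by
    have hcl := (hK.image continuous_fst).isClosed.closure_subset_iff.2 himg
    rw [closure_Ioc (by norm_num)] at hcl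
    exact hcl ⟨le_rfl, zero_le_one⟩
  obtain ⟨⟨s, t⟩, ⟨-, hq⟩, hs⟩ := h0
  change s = 0 at hs
  subst hs
  exact ⟨t, by simpa using hq⟩

/-! ### The oval of a definite pencil -/

/-- The component of the complement of a determinantal curve around a definite point consists of
the definite points. -/
theorem connectedComponentIn_eq_posDef {L : Fin 3 → Matrix (Fin 3) (Fin 3) ℝ}
    (hL : ∀ i, (L i).IsSymm) {e : Fin 3 → ℝ} (he : (matAt L e).PosDef) :
    connectedComponentIn {x | (matAt L x).det ≠ 0} e = {x | (matAt L x).PosDef} := by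
  have hs := isSymm_matAt hL
  have hsub : {x | (matAt L x).PosDef} ⊆ {x | (matAt L x).det ≠ 0} := fun x hx => hx.det_pos.ne'
  refine Set.Subset.antisymm ?_ (IsPreconnected.subset_connectedComponentIn ?_ he hsub)
  · refine IsPreconnected.subset_left_of_subset_union (isOpen_posDef (continuous_matAt L) hs)
      (isClosed_posSemidef (continuous_matAt L) hs).isOpen_compl ?_ ?_
      ⟨e, mem_connectedComponentIn (hsub he), he⟩ isPreconnected_connectedComponentIn
    · exact Set.disjoint_compl_right_iff_subset.2 fun x hx => hx.posSemidef
    · intro x hx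
      have hx' : (matAt L x).det ≠ 0 := connectedComponentIn_subset _ _ hx
      by_cases hp : (matAt L x).PosSemidef
      · exact Or.inl (hp.posDef_iff_isUnit.2 ((isUnit_iff_isUnit_det _).2 hx'.isUnit))
      · exact Or.inr hp
  · refine Convex.isPreconnected fun x hx y hy a b ha hb hab => ?_
    simp only [Set.mem_ofPred_eq] at hx hy ⊢
    rw [matAt_add, matAt_smul, matAt_smul]
    rcases ha.eq_or_lt with rfl | ha
    · have : b = 1 := by linarith
      simpa [this] using hy
    · exact PosDef.add_posSemidef (hx.smul ha) (hy.posSemidef.smul hb)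

/-- The boundary of the cone of definite points spans the cone of semidefinite points: a line
through a definite point in a direction with indefinite value meets the cone in a segment. -/
theorem convexHull_frontier_posDef {L : Fin 3 → Matrix (Fin 3) (Fin 3) ℝ}
    (hL : ∀ i, (L i).IsSymm) {e x : Fin 3 → ℝ} (he : (matAt L e).PosDef)
    (hx1 : 0 < matAt L x 1 1) (hx2 : matAt L x 2 2 < 0) :
    convexHull ℝ (frontier {v | (matAt L v).PosDef}) = {v | (matAt L v).PosSemidef} := by
  have hs := isSymm_matAt hL
  have hopen := isOpen_posDef (continuous_matAt L) hs
  have hclosed := isClosed_posSemidef (continuous_matAt L) hs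
  have hclosure : closure {v | (matAt L v).PosDef} = {v | (matAt L v).PosSemidef} := by
    refine Set.Subset.antisymm (closure_minimal (fun v hv => hv.posSemidef) hclosed) fun v hv => ?_
    have hlim : Tendsto (fun ε : ℝ => v + ε • e) (𝓝[>] 0) (𝓝 v) := by
      have : Continuous fun ε : ℝ => v + ε • e := by fun_prop
      simpa using (this.tendsto 0).mono_left nhdsWithin_le_nhds
    refine mem_closure_of_tendsto hlim (eventually_mem_nhdsWithin.mono fun ε hε => ?_)
    simp only [Set.mem_ofPred_eq]
    rw [matAt_add, matAt_smul]
    exact PosDef.posSemidef_add hv (he.smul hε)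
  rw [hopen.frontier_eq, hclosure]
  refine Set.Subset.antisymm (convexHull_min Set.sdiff_subset ?_) fun v hv => ?_
  · intro a ha b hb s t hs' ht' _
    simp only [Set.mem_ofPred_eq] at ha hb ⊢
    rw [matAt_add, matAt_smul, matAt_smul]
    exact (ha.smul hs').add (hb.smul ht')
  by_cases hpd : (matAt L v).PosDef
  swap
  · exact subset_convexHull ℝ _ ⟨hv, hpd⟩
  let γ : ℝ → Fin 3 → ℝ := fun t => v + t • x
  have hγ : Continuous γ := by fun_prop
  let I : Set ℝ := γ ⁻¹' {v | (matAt L v).PosSemidef}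
  have hI0 : (0 : ℝ) ∈ I := by simpa [I, γ] using hv
  have hI : IsCompact I := by
    refine Metric.isCompact_of_isClosed_isBounded (hclosed.preimage hγ)
      ((Metric.isBounded_Icc (-(matAt L v 1 1) / matAt L x 1 1)
        (matAt L v 2 2 / -(matAt L x 2 2))).subset fun t ht => ?_)
    have ht' : (matAt L v + t • matAt L x).PosSemidef := by
      have : (matAt L (v + t • x)).PosSemidef := ht
      rwa [matAt_add, matAt_smul] at this
    have d1 := ht'.diag_nonneg (i := 1)
    have d2 := ht'.diag_nonneg (i := 2)
    simp only [Matrix.add_apply, Matrix.smul_apply, smul_eq_mul] at d1 d2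
    constructor
    · rw [div_le_iff₀ hx1]; linarith
    · rw [le_div_iff₀ (by linarith)]; linarith
  have hopenI : IsOpen (γ ⁻¹' {v | (matAt L v).PosDef}) := hopen.preimage hγ
  obtain ⟨b, hbI, hb⟩ := hI.exists_isGreatest ⟨0, hI0⟩
  obtain ⟨a, haI, ha⟩ := hI.exists_isLeast ⟨0, hI0⟩
  have hbB : γ b ∈ {v | (matAt L v).PosSemidef} \ {v | (matAt L v).PosDef} := by
    refine ⟨hbI, fun hcon => ?_⟩
    obtain ⟨c, hc, hcI⟩ := ((eventually_mem_nhdsWithin (s := Set.Ioi b)).and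
      ((hopenI.eventually_mem hcon).filter_mono nhdsWithin_le_nhds)).exists
    exact absurd (hb (show c ∈ I from PosDef.posSemidef hcI)) (not_le.2 hc)
  have haB : γ a ∈ {v | (matAt L v).PosSemidef} \ {v | (matAt L v).PosDef} := by
    refine ⟨haI, fun hcon => ?_⟩
    obtain ⟨c, hc, hcI⟩ := ((eventually_mem_nhdsWithin (s := Set.Iio a)).and
      ((hopenI.eventually_mem hcon).filter_mono nhdsWithin_le_nhds)).exists
    exact absurd (ha (show c ∈ I from PosDef.posSemidef hcI)) (not_le.2 hc)
  have ha0 : a ≤ 0 := ha hI0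
  have hb0 : 0 ≤ b := hb hI0
  have hb0' : 0 < b := hb0.lt_of_ne (by rintro rfl; exact hbB.2 (by simpa [γ] using hpd))
  have hv' : v = (b / (b - a)) • γ a + (-a / (b - a)) • γ b := by
    have : b - a ≠ 0 := by linarith
    ext i
    simp only [γ, Pi.add_apply, Pi.smul_apply, smul_eq_mul]
    field_simp
    ring
  rw [hv']
  refine (convex_convexHull ℝ _) (subset_convexHull ℝ _ haB) (subset_convexHull ℝ _ hbB)
    (div_nonneg hb0 (by linarith)) (div_nonneg (by linarith) (by linarith)) ?_
  have : b - a ≠ 0 := by linarith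
  field_simp
  ring

/-- The convex hull of the oval around a definite point is the set of semidefinite points. -/
theorem ovalHull_eq_of_posDef {L : Fin 3 → Matrix (Fin 3) (Fin 3) ℝ} (hL : ∀ i, (L i).IsSymm)
    (hsurj : ∀ a b c : ℝ, ∃ y, matAt L y 1 1 = a ∧ matAt L y 1 2 = b ∧ matAt L y 2 2 = c)
    {f : MvPolynomial (Fin 3) ℝ} {c : ℝ} (hc : c ≠ 0)
    (hf : ∀ y, MvPolynomial.eval y f = c * (matAt L y).det)
    {e : Fin 3 → ℝ} (he : (matAt L e).PosDef) :
    ovalHull f e = {y | ∃ (v : Fin 3 → ℝ) (hv : v ≠ 0),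
      (matAt L v).PosSemidef ∧ Projectivization.mk ℝ v hv = y} := by
  obtain ⟨x, hx1, -, hx2⟩ := hsurj 1 0 (-1)
  have hset : {x | MvPolynomial.eval x f ≠ 0} = {x | (matAt L x).det ≠ 0} := by
    ext y; simp [hf, hc]
  rw [ovalHull, ovalHalfCone, hset, connectedComponentIn_eq_posDef hL he,
    convexHull_frontier_posDef hL he (by rw [hx1]; norm_num) (by rw [hx2]; norm_num)]
  rfl

theorem ovalHull_eq_of_definite {L : Fin 3 → Matrix (Fin 3) (Fin 3) ℝ} (hL : ∀ i, (L i).IsSymm)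
    (hsurj : ∀ a b c : ℝ, ∃ y, matAt L y 1 1 = a ∧ matAt L y 1 2 = b ∧ matAt L y 2 2 = c)
    {f : MvPolynomial (Fin 3) ℝ} {c : ℝ} (hc : c ≠ 0)
    (hf : ∀ y, MvPolynomial.eval y f = c * (matAt L y).det)
    {e : Fin 3 → ℝ} (he : (matAt L e).PosDef ∨ (matAt L (-e)).PosDef) :
    ovalHull f e = {y | ∃ (v : Fin 3 → ℝ) (hv : v ≠ 0),
      (matAt L v).PosSemidef ∧ Projectivization.mk ℝ v hv = y} := by
  rcases he with he | he
  · exact ovalHull_eq_of_posDef hL hsurj hc hf he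
  have hmat : ∀ x, matAt (fun i => -L i) x = matAt L (-x) := fun x => by simp [matAt]
  have hdet : ∀ x, (matAt (fun i => -L i) x).det = -(matAt L x).det := fun x => by
    rw [hmat, matAt_neg, det_neg]; simp; norm_num
  rw [ovalHull_eq_of_posDef (L := fun i => -L i) (fun i => (hL i).neg) (fun a b c => by
      obtain ⟨y, h⟩ := hsurj a b c
      exact ⟨-y, by simpa only [hmat, neg_neg] using h⟩) (neg_ne_zero.2 hc)
      (fun y => by rw [hf, hdet]; ring) (by rwa [hmat])]
  have hneg : ∀ (v : Fin 3 → ℝ) (hv : v ≠ 0), Projectivization.mk ℝ (-v) (neg_ne_zero.2 hv) =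
      Projectivization.mk ℝ v hv := fun v hv =>
    (Projectivization.mk_eq_mk_iff' ℝ _ _ _ _).2 ⟨-1, by simp⟩
  ext y
  constructor
  · rintro ⟨v, hv, h1, h2⟩
    exact ⟨-v, neg_ne_zero.2 hv, by rwa [hmat] at h1, (hneg v hv).trans h2⟩
  · rintro ⟨v, hv, h1, h2⟩
    exact ⟨-v, neg_ne_zero.2 hv, by rwa [hmat, neg_neg], (hneg v hv).trans h2⟩

/-! ### Singular points and nodes of symmetroids -/

theorem det_four_of_isSymm {R : Type*} [CommRing R] {N : Matrix (Fin 4) (Fin 4) R}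
    (hN : N.IsSymm) :
    N.det = (N 0 0 * N 1 1 - N 0 1 ^ 2) * (N 2 2 * N 3 3 - N 2 3 ^ 2) -
      (N 1 2 * N 1 2 * (N 3 3 * N 0 0) + N 1 3 * N 1 3 * (N 2 2 * N 0 0) -
        2 * (N 1 2 * N 1 3 * (N 2 3 * N 0 0)) -
        2 * (N 0 2 * N 1 2 * (N 3 3 * N 0 1) - N 0 2 * N 1 3 * (N 2 3 * N 0 1) -
          N 0 3 * N 1 2 * (N 2 3 * N 0 1) + N 0 3 * N 1 3 * (N 2 2 * N 0 1)) +
        N 0 2 * N 0 2 * (N 3 3 * N 1 1) + N 0 3 * N 0 3 * (N 2 2 * N 1 1) -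
        2 * (N 0 2 * N 0 3 * (N 2 3 * N 1 1))) +
      (N 0 2 * N 1 3 * (N 0 2 * N 1 3) - 2 * (N 0 2 * N 1 3 * (N 0 3 * N 1 2)) +
        N 0 3 * N 1 2 * (N 0 3 * N 1 2)) := by
  simp [det_succ_row_zero, Fin.sum_univ_succ, Fin.succAbove, hN.apply 0 1, hN.apply 0 2,
    hN.apply 0 3, hN.apply 1 2, hN.apply 1 3, hN.apply 2 3]
  ring

/-- The entries of a pencil, as linear forms. -/
noncomputable def pencilEntries {m n : ℕ} (B : Fin m → Matrix (Fin n) (Fin n) ℝ) :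
    Matrix (Fin n) (Fin n) (MvPolynomial (Fin m) ℝ) :=
  ∑ k, (MvPolynomial.X k : MvPolynomial (Fin m) ℝ) • (B k).map MvPolynomial.C

theorem pencilEntries_apply {m n : ℕ} (B : Fin m → Matrix (Fin n) (Fin n) ℝ) (i j : Fin n) :
    pencilEntries B i j = ∑ k, MvPolynomial.X k * MvPolynomial.C (B k i j) := by
  simp [pencilEntries, Matrix.sum_apply]

theorem eval_pencilEntries {m n : ℕ} (B : Fin m → Matrix (Fin n) (Fin n) ℝ) (x : Fin m → ℝ)
    (i j : Fin n) : MvPolynomial.eval x (pencilEntries B i j) = matAt B x i j := by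
  simp [pencilEntries_apply, matAt_apply]

theorem pderiv_pencilEntries {m n : ℕ} (B : Fin m → Matrix (Fin n) (Fin n) ℝ) (k : Fin m)
    (i j : Fin n) :
    MvPolynomial.pderiv k (pencilEntries B i j) = MvPolynomial.C (B k i j) := by
  rw [pencilEntries_apply, map_sum, Finset.sum_eq_single k]
  · simp [Derivation.leibniz]
  · intro l _ hl
    simp [Derivation.leibniz, MvPolynomial.pderiv_X_of_ne hl]
  · simp

theorem isSymm_pencilEntries {m n : ℕ} {B : Fin m → Matrix (Fin n) (Fin n) ℝ}
    (hB : ∀ i, (B i).IsSymm) : (pencilEntries B).IsSymm := by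
  refine IsSymm.ext fun i j => ?_
  simp only [pencilEntries_apply, (hB _).apply i j]

theorem eval_pderiv_pderiv_mul_mul_eq_zero {m : ℕ} {x : Fin m → ℝ}
    {a b c : MvPolynomial (Fin m) ℝ} (ha : MvPolynomial.eval x a = 0)
    (hb : MvPolynomial.eval x b = 0) (hc : MvPolynomial.eval x c = 0) (i j : Fin m) :
    MvPolynomial.eval x (MvPolynomial.pderiv i (MvPolynomial.pderiv j (a * b * c))) = 0 := by
  simp [Derivation.leibniz, ha, hb, hc]

/-- The gradient of the determinant at a point whose matrix has the last coordinate vector in its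
kernel. The factor `μ` is the upper left `3 × 3` minor of this matrix. -/
theorem eval_pderiv_detForm {m : ℕ} {B : Fin m → Matrix (Fin 4) (Fin 4) ℝ}
    (hB : ∀ i, (B i).IsSymm) {x : Fin m → ℝ} (h03 : matAt B x 0 3 = 0) (h13 : matAt B x 1 3 = 0)
    (h23 : matAt B x 2 3 = 0) (h33 : matAt B x 3 3 = 0) (k : Fin m) :
    ∃ μ : ℝ, MvPolynomial.eval x (MvPolynomial.pderiv k (detForm B)) = B k 3 3 * μ ∧
      (matAt B x 0 2 = 0 → matAt B x 1 2 = 0 → matAt B x 2 2 = 0 → μ = 0) := by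
  refine ⟨(matAt B x 0 0 * matAt B x 1 1 - matAt B x 0 1 ^ 2) * matAt B x 2 2 -
    (matAt B x 1 2 * matAt B x 1 2 * matAt B x 0 0 -
      2 * (matAt B x 0 2 * matAt B x 1 2 * matAt B x 0 1) +
      matAt B x 0 2 * matAt B x 0 2 * matAt B x 1 1), ?_, fun h1 h2 h3 => by
        rw [h1, h2, h3]; ring⟩
  change MvPolynomial.eval x (MvPolynomial.pderiv k (pencilEntries B).det) = _
  rw [det_four_of_isSymm (isSymm_pencilEntries hB)]
  simp only [map_add, map_sub, Derivation.leibniz, Derivation.leibniz_pow, smul_eq_mul,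
    pderiv_pencilEntries, map_mul, map_pow, eval_pencilEntries, MvPolynomial.eval_C,
    h03, h13, h23, h33, nsmul_eq_mul]
  simp
  ring

/-- The Hessian of the determinant at a point whose matrix has the last two coordinate vectors in
its kernel: up to a constant, it is the Hessian of the determinant of the lower right block. -/
theorem eval_pderiv_pderiv_detForm {m : ℕ} {B : Fin m → Matrix (Fin 4) (Fin 4) ℝ}
    (hB : ∀ i, (B i).IsSymm) {x : Fin m → ℝ} (h02 : matAt B x 0 2 = 0) (h12 : matAt B x 1 2 = 0)
    (h03 : matAt B x 0 3 = 0) (h13 : matAt B x 1 3 = 0) (h22 : matAt B x 2 2 = 0)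
    (h23 : matAt B x 2 3 = 0) (h33 : matAt B x 3 3 = 0) (i j : Fin m) :
    MvPolynomial.eval x (MvPolynomial.pderiv i (MvPolynomial.pderiv j (detForm B))) =
      (matAt B x 0 0 * matAt B x 1 1 - matAt B x 0 1 ^ 2) *
        (B i 2 2 * B j 3 3 + B j 2 2 * B i 3 3 - 2 * B i 2 3 * B j 2 3) := by
  change MvPolynomial.eval x (MvPolynomial.pderiv i (MvPolynomial.pderiv j
    (pencilEntries B).det)) = _
  have e := eval_pencilEntries B x
  have hC : ∀ k (g : MvPolynomial (Fin m) ℝ), MvPolynomial.pderiv k (2 * g) =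
      2 * MvPolynomial.pderiv k g := fun k g => by
    rw [← map_ofNat MvPolynomial.C, MvPolynomial.pderiv_C_mul]
  have v2 : ∀ {a b : MvPolynomial (Fin m) ℝ}, MvPolynomial.eval x a = 0 →
      MvPolynomial.eval x (a * b) = 0 := fun h => by rw [map_mul, h, zero_mul]
  have e02 := (e 0 2).trans h02
  have e12 := (e 1 2).trans h12
  have e03 := (e 0 3).trans h03
  have e13 := (e 1 3).trans h13
  have e22 := (e 2 2).trans h22
  have e23 := (e 2 3).trans h23
  have e33 := (e 3 3).trans h33
  have z := fun {a b c : MvPolynomial (Fin m) ℝ} (ha : MvPolynomial.eval x a = 0)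
    (hb : MvPolynomial.eval x b = 0) (hc : MvPolynomial.eval x c = 0) =>
    eval_pderiv_pderiv_mul_mul_eq_zero ha hb hc i j
  rw [det_four_of_isSymm (isSymm_pencilEntries hB)]
  simp only [map_add, map_sub, hC, map_mul (MvPolynomial.eval x) 2]
  rw [z e12 e12 (v2 e33), z e13 e13 (v2 e22), z e12 e13 (v2 e23), z e02 e12 (v2 e33),
    z e02 e13 (v2 e23), z e03 e12 (v2 e23), z e03 e13 (v2 e22), z e02 e02 (v2 e33),
    z e03 e03 (v2 e22), z e02 e03 (v2 e23), z e02 e13 (v2 e02), z e02 e13 (v2 e03),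
    z e03 e12 (v2 e03)]
  simp only [map_add, map_sub, Derivation.leibniz, Derivation.leibniz_pow, smul_eq_mul,
    pderiv_pencilEntries, map_mul, map_pow, eval_pencilEntries, MvPolynomial.eval_C,
    h22, h23, h33, nsmul_eq_mul, MvPolynomial.pderiv_C]
  simp
  left
  ring

/-- At a node, the restriction of the pencil to a two-dimensional kernel spans the whole space of
symmetric `2 × 2` matrices, as otherwise the Hessian of the determinant would have rank at
most two. -/
theorem exists_matAt_eq_of_rank_hessian {B : Fin 4 → Matrix (Fin 4) (Fin 4) ℝ}
    (hB : ∀ i, (B i).IsSymm) {x : Fin 4 → ℝ} (h2 : ∀ i, matAt B x i 2 = 0)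
    (h3 : ∀ i, matAt B x i 3 = 0)
    (hrank : (Matrix.of fun i j => MvPolynomial.eval x
      (MvPolynomial.pderiv i (MvPolynomial.pderiv j (detForm B)))).rank = 3) (a b c : ℝ) :
    ∃ v, matAt B v 2 2 = a ∧ matAt B v 2 3 = b ∧ matAt B v 3 3 = c := by
  let U : Matrix (Fin 4) (Fin 3) ℝ := Matrix.of fun i => ![B i 2 2, B i 2 3, B i 3 3]
  let V : Matrix (Fin 3) (Fin 4) ℝ := Matrix.of fun k j =>
    (matAt B x 0 0 * matAt B x 1 1 - matAt B x 0 1 ^ 2) *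
      ![B j 3 3, -2 * B j 2 3, B j 2 2] k
  have hUV : (Matrix.of fun i j => MvPolynomial.eval x
      (MvPolynomial.pderiv i (MvPolynomial.pderiv j (detForm B)))) = U * V := by
    ext i j
    rw [of_apply, eval_pderiv_pderiv_detForm hB (h2 0) (h2 1) (h3 0) (h3 1) (h2 2) (h3 2) (h3 3),
      mul_apply, Fin.sum_univ_three]
    simp [U, V]
    ring
  have hU : Uᵀ.rank = 3 := by
    refine le_antisymm (by simpa using Uᵀ.rank_le_height) ?_
    calc 3 = (U * V).rank := by rw [← hUV, hrank]
      _ ≤ U.rank := rank_mul_le_left U V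
      _ = Uᵀ.rank := U.rank_transpose.symm
  have htop : LinearMap.range Uᵀ.mulVecLin = ⊤ :=
    Submodule.eq_top_of_finrank_eq (by rw [← Matrix.rank, hU]; simp)
  obtain ⟨v, hv⟩ := LinearMap.range_eq_top.1 htop ![a, b, c]
  have hv' : ∀ k, ∑ i, v i * U i k = ![a, b, c] k := fun k => by
    rw [← hv]; simp [vecMul, dotProduct]
  refine ⟨v, ?_, ?_, ?_⟩
  · simpa [matAt_apply, U] using hv' 0
  · simpa [matAt_apply, U] using hv' 1
  · simpa [matAt_apply, U] using hv' 2

theorem isSymm_congr {n : ℕ} {M : Matrix (Fin n) (Fin n) ℝ} (hM : M.IsSymm)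
    (P : Matrix (Fin n) (Fin n) ℝ) : (Pᵀ * M * P).IsSymm := by
  rw [IsSymm, transpose_mul, transpose_mul, transpose_transpose, hM.eq, Matrix.mul_assoc]

theorem isSingularPoint_congr_iff {A : Fin 4 → Matrix (Fin 4) (Fin 4) ℝ}
    {P : Matrix (Fin 4) (Fin 4) ℝ} (hP : IsUnit P.det) (x : Fin 4 → ℝ) :
    IsSingularPoint (detForm fun i => Pᵀ * A i * P) x ↔ IsSingularPoint (detForm A) x := by
  have h := hP.ne_zero
  simp [IsSingularPoint, detForm_congr, h]

theorem rank_hessian_congr {A : Fin 4 → Matrix (Fin 4) (Fin 4) ℝ}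
    {P : Matrix (Fin 4) (Fin 4) ℝ} (hP : IsUnit P.det) (x : Fin 4 → ℝ) :
    (Matrix.of fun i j => MvPolynomial.eval x (MvPolynomial.pderiv i (MvPolynomial.pderiv j
      (detForm fun i => Pᵀ * A i * P)))).rank = (Matrix.of fun i j => MvPolynomial.eval x
      (MvPolynomial.pderiv i (MvPolynomial.pderiv j (detForm A)))).rank := by
  have h : (Matrix.of fun i j => MvPolynomial.eval x (MvPolynomial.pderiv i (MvPolynomial.pderiv j
      (detForm fun i => Pᵀ * A i * P)))) = (P.det ^ 2) • (Matrix.of fun i j => MvPolynomial.eval x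
      (MvPolynomial.pderiv i (MvPolynomial.pderiv j (detForm A)))) := by
    ext i j
    simp [detForm_congr]
  rw [h, rank_smul_of_mem_nonZeroDivisors _
    (mem_nonZeroDivisors_of_ne_zero (pow_ne_zero 2 hP.ne_zero))]

theorem rank_congr {n : ℕ} {P : Matrix (Fin n) (Fin n) ℝ} (hP : IsUnit P.det)
    (M : Matrix (Fin n) (Fin n) ℝ) : (Pᵀ * M * P).rank = M.rank := by
  rw [rank_mul_eq_left_of_isUnit_det _ _ hP,
    rank_mul_eq_right_of_isUnit_det _ _ (by rwa [det_transpose])]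

theorem posDef_congr_iff {n : ℕ} {P : Matrix (Fin n) (Fin n) ℝ} (hP : IsUnit P.det)
    (M : Matrix (Fin n) (Fin n) ℝ) : (Pᵀ * M * P).PosDef ↔ M.PosDef := by
  have := IsUnit.posDef_star_left_conjugate_iff (x := M) ((isUnit_iff_isUnit_det P).2 hP)
  rwa [star_eq_conjTranspose, conjTranspose_eq_transpose_of_trivial] at this

/-- Diagonalization of a symmetric matrix by a congruence, with a prescribed order of the
eigenvalues. -/
theorem exists_congr_diagonal {n : ℕ} {M : Matrix (Fin n) (Fin n) ℝ} (hM : M.IsSymm) :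
    ∃ d : Fin n → ℝ, ∀ σ : Equiv.Perm (Fin n), ∃ P : Matrix (Fin n) (Fin n) ℝ,
      IsUnit P.det ∧ Pᵀ * M * P = diagonal (d ∘ σ) := by
  have hH : M.IsHermitian := (conjTranspose_eq_transpose_of_trivial M).trans hM
  let U : Matrix (Fin n) (Fin n) ℝ := hH.eigenvectorUnitary
  have hUU : Uᵀ * U = 1 := by
    have := (Unitary.mem_iff.1 hH.eigenvectorUnitary.2).1
    rwa [star_eq_conjTranspose, conjTranspose_eq_transpose_of_trivial] at this
  have hU : Uᵀ * M * U = diagonal hH.eigenvalues := by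
    have h := hH.spectral_theorem
    rw [Unitary.conjStarAlgAut_apply, star_eq_conjTranspose,
      conjTranspose_eq_transpose_of_trivial] at h
    change M = U * diagonal hH.eigenvalues * Uᵀ at h
    calc Uᵀ * M * U = (Uᵀ * U) * diagonal hH.eigenvalues * (Uᵀ * U) := by
          conv_lhs => rw [h]
          simp only [Matrix.mul_assoc]
      _ = _ := by rw [hUU, Matrix.one_mul, Matrix.mul_one]
  refine ⟨hH.eigenvalues, fun σ => ⟨U.submatrix id σ, ?_, ?_⟩⟩
  · rw [det_permute']
    have : IsUnit U.det := (isUnit_iff_isUnit_det _).1 (IsUnit.of_mul_eq_one_right _ hUU)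
    refine IsUnit.mul ?_ this
    exact ((Equiv.Perm.sign σ).isUnit.map (Int.castRingHom ℝ))
  · have h1 : (U.submatrix id σ)ᵀ * M * U.submatrix id σ = (Uᵀ * M * U).submatrix σ σ := by
      ext i j
      simp [mul_apply]
    rw [h1, hU, submatrix_diagonal_equiv]

/-- A pencil with a positive semidefinite value contains a positive definite matrix if the point is
not singular, or is a node of rank two: some value of the pencil is positive definite on the kernel,
and a small step in this direction suffices. -/
theorem exists_posDef_of_posSemidef {A : Fin 4 → Matrix (Fin 4) (Fin 4) ℝ}
    (hA : ∀ i, (A i).IsSymm) {x : Fin 4 → ℝ} (hx : x ≠ 0) (hpsd : (matAt A x).PosSemidef)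
    (hsing : IsSingularPoint (detForm A) x → IsNode (detForm A) x ∧ (matAt A x).rank = 2) :
    ∃ v, (matAt A v).PosDef := by
  obtain ⟨d, hd⟩ := exists_congr_diagonal (isSymm_matAt hA x)
  -- It suffices to find a direction that is positive on the kernel after the congruence.
  have main : ∀ (P : Matrix (Fin 4) (Fin 4) ℝ) (v : Fin 4 → ℝ), IsUnit P.det →
      (∀ z : Fin 4 → ℝ, z ≠ 0 → (Pᵀ * matAt A x * P) *ᵥ z = 0 →
        0 < z ⬝ᵥ (Pᵀ * matAt A v * P) *ᵥ z) → ∃ v, (matAt A v).PosDef := by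
    intro P v hP hz
    have hpsd' : (Pᵀ * matAt A x * P).PosSemidef := by
      simpa [conjTranspose_eq_transpose_of_trivial] using hpsd.conjTranspose_mul_mul_same P
    obtain ⟨ε, -, hε⟩ := exists_posDef_add_smul hpsd' (isSymm_congr (isSymm_matAt hA v) P) hz
    refine ⟨x + ε • v, (posDef_congr_iff hP _).1 ?_⟩
    rw [matAt_add, matAt_smul]
    simpa [Matrix.mul_add, Matrix.add_mul] using hε
  have hrank : (matAt A x).rank = Fintype.card {i // d i ≠ 0} := by
    obtain ⟨P, hP, hPd⟩ := hd 1
    rw [← rank_congr hP, hPd, rank_diagonal]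
    rfl
  by_cases hall : ∀ i, d i ≠ 0
  · refine ⟨x, hpsd.posDef_iff_isUnit.2 ?_⟩
    obtain ⟨P, hP, hPd⟩ := hd 1
    have h1 : (Pᵀ * matAt A x * P).det ≠ 0 := by
      rw [hPd, det_diagonal]
      exact Finset.prod_ne_zero_iff.2 fun i _ => hall _
    rw [det_mul, det_mul] at h1
    exact (isUnit_iff_isUnit_det _).2 (right_ne_zero_of_mul (left_ne_zero_of_mul h1)).isUnit
  push Not at hall
  obtain ⟨j, hj⟩ := hall
  by_cases htwo : ∃ i, i ≠ j ∧ d i = 0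
  · obtain ⟨i, hij, hi⟩ := htwo
    obtain ⟨σ, hσ2, hσ3⟩ : ∃ σ : Equiv.Perm (Fin 4), σ 2 = i ∧ σ 3 = j := by
      have hperm : ∀ i j : Fin 4, i ≠ j → ∃ σ : Equiv.Perm (Fin 4), σ 2 = i ∧ σ 3 = j := by
        decide
      exact hperm i j hij
    obtain ⟨P, hP, hPd⟩ := hd σ
    let B : Fin 4 → Matrix (Fin 4) (Fin 4) ℝ := fun i => Pᵀ * A i * P
    have hB : ∀ i, (B i).IsSymm := fun i => isSymm_congr (hA i) P
    have hBx : matAt B x = diagonal (d ∘ σ) := (matAt_congr A P x).trans hPd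
    have h2 : ∀ k, matAt B x k 2 = 0 := fun k => by
      rw [hBx, diagonal_apply]; split_ifs with h <;> simp [*]
    have h3 : ∀ k, matAt B x k 3 = 0 := fun k => by
      rw [hBx, diagonal_apply]; split_ifs with h <;> simp [*]
    have hs : IsSingularPoint (detForm B) x := by
      refine ⟨hx, ?_, fun k => ?_⟩
      · rw [eval_detForm, hBx, det_diagonal]
        exact Finset.prod_eq_zero (Finset.mem_univ 3) (by simp [hσ3, hj])
      · obtain ⟨μ, h, hμ⟩ := eval_pderiv_detForm hB (h3 0) (h3 1) (h3 2) (h3 3) k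
        rw [h, hμ (h2 0) (h2 1) (h2 2), mul_zero]
    obtain ⟨⟨-, hhess⟩, hr2⟩ := hsing ((isSingularPoint_congr_iff hP x).1 hs)
    rw [← rank_hessian_congr hP] at hhess
    obtain ⟨v, v1, v2, v3⟩ := exists_matAt_eq_of_rank_hessian hB h2 h3 hhess 1 0 1
    rw [hrank, Fintype.card_subtype] at hr2
    have hne : ∀ k, k ≠ 2 → k ≠ 3 → d (σ k) ≠ 0 := by
      intro k hk2 hk3 hk
      have hsub : (Finset.univ.filter fun i => d i ≠ 0) ⊆
          (Finset.univ.erase (σ k) |>.erase i |>.erase j) := by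
        intro l hl
        simp only [Finset.mem_filter, Finset.mem_univ, true_and] at hl
        simp only [Finset.mem_erase, Finset.mem_univ, and_true]
        exact ⟨fun h => hl (h ▸ hj), fun h => hl (h ▸ hi), fun h => hl (h ▸ hk)⟩
      have hcard := Finset.card_le_card hsub
      have hki : i ≠ σ k := fun h => hk2 (σ.injective (h.symm.trans hσ2.symm))
      have hkj : j ≠ σ k := fun h => hk3 (σ.injective (h.symm.trans hσ3.symm))
      rw [hr2, Finset.card_erase_of_mem (by simp [hij.symm, hkj]),
        Finset.card_erase_of_mem (by simp [hki]), Finset.card_erase_of_mem (by simp)] at hcard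
      simp at hcard
    refine main P v hP fun z hz hker => ?_
    rw [hPd] at hker
    have hz0 : z 0 = 0 := by
      have := congrFun hker 0
      rw [mulVec_diagonal] at this
      exact (mul_eq_zero.1 this).resolve_left (hne 0 (by decide) (by decide))
    have hz1 : z 1 = 0 := by
      have := congrFun hker 1
      rw [mulVec_diagonal] at this
      exact (mul_eq_zero.1 this).resolve_left (hne 1 (by decide) (by decide))
    rw [← matAt_congr]
    have v2' : matAt B v 3 2 = 0 := by rw [(isSymm_matAt hB v).apply 2 3, v2]
    have hq : z ⬝ᵥ matAt B v *ᵥ z = z 2 ^ 2 + z 3 ^ 2 := by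
      simp [dotProduct, mulVec, Fin.sum_univ_four, hz0, hz1, v1, v2, v3, v2']
      ring
    change 0 < z ⬝ᵥ matAt B v *ᵥ z
    rw [hq]
    by_cases hz2 : z 2 = 0
    · have hz3 : z 3 ≠ 0 := fun hz3 => hz (by
        ext i; fin_cases i <;> simp [hz0, hz1, hz2, hz3])
      positivity
    · positivity
  · push Not at htwo
    obtain ⟨P, hP, hPd⟩ := hd (Equiv.swap 3 j)
    have hσ3 : Equiv.swap 3 j 3 = j := Equiv.swap_apply_left 3 j
    have hne : ∀ k, k ≠ 3 → d (Equiv.swap 3 j k) ≠ 0 := fun k hk =>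
      htwo _ fun h => hk ((Equiv.swap 3 j).injective (h.trans hσ3.symm))
    let B : Fin 4 → Matrix (Fin 4) (Fin 4) ℝ := fun i => Pᵀ * A i * P
    have hB : ∀ i, (B i).IsSymm := fun i => isSymm_congr (hA i) P
    have hBx : matAt B x = diagonal (d ∘ Equiv.swap 3 j) := (matAt_congr A P x).trans hPd
    have h3 : ∀ k, matAt B x k 3 = 0 := fun k => by
      rw [hBx, diagonal_apply]; split_ifs with h <;> simp [*]
    have hr3 : (matAt A x).rank = 3 := by
      rw [hrank, Fintype.card_subtype]
      have : (Finset.univ.filter fun i => d i ≠ 0) = Finset.univ.erase j := by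
        ext l
        simp only [Finset.mem_filter, Finset.mem_univ, true_and, Finset.mem_erase, and_true]
        exact ⟨fun h hl => h (hl ▸ hj), fun h => htwo l h⟩
      rw [this, Finset.card_erase_of_mem (Finset.mem_univ j)]
      simp
    obtain ⟨k, hk⟩ : ∃ k, B k 3 3 ≠ 0 := by
      by_contra! hcon
      have hs : IsSingularPoint (detForm B) x := by
        refine ⟨hx, ?_, fun k => ?_⟩
        · rw [eval_detForm, hBx, det_diagonal]
          exact Finset.prod_eq_zero (Finset.mem_univ 3) (by simp [hj])
        · obtain ⟨μ, h, -⟩ := eval_pderiv_detForm hB (h3 0) (h3 1) (h3 2) (h3 3) k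
          rw [h, hcon, zero_mul]
      have := (hsing ((isSingularPoint_congr_iff hP x).1 hs)).2
      omega
    refine main P (Pi.single k (B k 3 3)) hP fun z hz hker => ?_
    rw [hPd] at hker
    have hz0 : ∀ i, i ≠ 3 → z i = 0 := fun i hi => by
      have := congrFun hker i
      rw [mulVec_diagonal] at this
      exact (mul_eq_zero.1 this).resolve_left (hne i hi)
    have hz3 : z 3 ≠ 0 := fun hz3 => hz (by
      ext i
      by_cases hi : i = 3
      · rw [hi, hz3]; rfl
      · exact hz0 i hi)
    rw [← matAt_congr]
    have hv : matAt B (Pi.single k (B k 3 3)) 3 3 = B k 3 3 ^ 2 := by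
      simp [matAt_apply, Pi.single_apply, sq]
    have hq : z ⬝ᵥ matAt B (Pi.single k (B k 3 3)) *ᵥ z = (B k 3 3 * z 3) ^ 2 := by
      simp [dotProduct, mulVec, Fin.sum_univ_four, hz0, hv]
      ring
    change 0 < z ⬝ᵥ matAt B _ *ᵥ z
    rw [hq]
    positivity

/-! ### The spectrahedron and its projection -/

theorem isSymm_nodeNormalForm : nodeNormalForm.IsSymm := by
  ext i j
  fin_cases i <;> fin_cases j <;> rfl

/-- The free entry of the pencil is not contained in the two principal submatrices that give the
ramification cubics. -/
theorem submatrix_smul_nodeNormalForm_add {k : Fin 4} (hk : k = 0 ∨ k = 1) (t : ℝ)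
    (X : Matrix (Fin 4) (Fin 4) ℝ) :
    (t • nodeNormalForm + X).submatrix k.succAbove k.succAbove =
      X.submatrix k.succAbove k.succAbove := by
  rcases hk with rfl | rfl <;> ext i j <;> fin_cases i <;> fin_cases j <;>
    simp [nodeNormalForm, Fin.succAbove]

theorem eval_tangentConic {B : Fin 4 → Matrix (Fin 4) (Fin 4) ℝ} (hB : ∀ i, (B i).IsSymm)
    (hB0 : B 0 = nodeNormalForm) (y : Fin 3 → ℝ) :
    MvPolynomial.eval y (tangentConic (detForm B)) =
      -(matAt (fun j : Fin 3 => B j.succ) y 2 2 * matAt (fun j : Fin 3 => B j.succ) y 3 3 -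
        matAt (fun j : Fin 3 => B j.succ) y 2 3 ^ 2) := by
  set M := matAt (fun j : Fin 3 => B j.succ) y with hM
  have hMs : M.IsSymm := isSymm_matAt (fun j => hB j.succ) y
  obtain ⟨b, hb⟩ : ∃ b : ℝ, ∀ t : ℝ, (t • nodeNormalForm + M).det =
      -(M 2 2 * M 3 3 - M 2 3 ^ 2) * t ^ 2 + b * t + M.det := by
    refine ⟨-2 * M 0 1 * (M 2 2 * M 3 3 - M 2 3 ^ 2) + 2 * (M 0 2 * M 1 2 * M 3 3 -
      (M 0 2 * M 1 3 + M 0 3 * M 1 2) * M 2 3 + M 0 3 * M 1 3 * M 2 2), fun t => ?_⟩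
    rw [det_four_of_isSymm ((isSymm_nodeNormalForm.smul t).add hMs), det_four_of_isSymm hMs]
    simp [nodeNormalForm]
    ring
  have hpoly : Polynomial.map (MvPolynomial.eval y) (MvPolynomial.finSuccEquiv ℝ 3 (detForm B)) =
      Polynomial.C (-(M 2 2 * M 3 3 - M 2 3 ^ 2)) * Polynomial.X ^ 2 +
        Polynomial.C b * Polynomial.X + Polynomial.C M.det := by
    refine Polynomial.funext fun t => ?_
    rw [← MvPolynomial.eval_eq_eval_mv_eval', eval_detForm, matAt_cons, hB0, hb]
    simp
  rw [tangentConic, coeffX0, ← Polynomial.coeff_map, hpoly, Polynomial.coeff_add,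
    Polynomial.coeff_add, Polynomial.coeff_C_mul_X_pow, Polynomial.coeff_C_mul_X,
    Polynomial.coeff_C]
  simp

theorem tangentConic_congr (A : Fin 4 → Matrix (Fin 4) (Fin 4) ℝ)
    (P : Matrix (Fin 4) (Fin 4) ℝ) (y : Fin 3 → ℝ) :
    MvPolynomial.eval y (tangentConic (detForm fun i => Pᵀ * A i * P)) =
      P.det ^ 2 * MvPolynomial.eval y (tangentConic (detForm A)) := by
  have hC : MvPolynomial.finSuccEquiv ℝ 3 (MvPolynomial.C (P.det ^ 2)) =
      Polynomial.C (MvPolynomial.C (P.det ^ 2)) := by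
    simp [MvPolynomial.finSuccEquiv_apply]
  rw [detForm_congr, tangentConic, tangentConic, coeffX0, coeffX0, map_mul, hC,
    Polynomial.coeff_C_mul, map_mul, MvPolynomial.eval_C]

/-- If the tangent conic interlaces both ramification cubics with respect to `e`, then the pencil
has a definite value over `e`: otherwise one of the cubics would vanish on the conic, and the
kernels of the matrices over the conic would provide a line through the node. -/
theorem exists_posDef_of_interlaces {M : Fin 3 → Matrix (Fin 4) (Fin 4) ℝ}
    (hM : ∀ i, (M i).IsSymm)
    (hsurj : ∀ a b c : ℝ, ∃ y, matAt M y 2 2 = a ∧ matAt M y 2 3 = b ∧ matAt M y 3 3 = c)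
    (hker : ∀ (y : Fin 3 → ℝ) (k : Fin 4 → ℝ), k 0 = 0 → k 1 = 0 → k ≠ 0 →
      matAt M y *ᵥ k = 0 → y = 0)
    {h f₀ f₁ : MvPolynomial (Fin 3) ℝ} {d : ℝ} (hd : d ≠ 0)
    (hh : ∀ y, MvPolynomial.eval y h =
      d * (matAt M y 2 2 * matAt M y 3 3 - matAt M y 2 3 ^ 2))
    (hf₀ : ∀ y, MvPolynomial.eval y f₀ =
      ((matAt M y).submatrix (Fin.succAbove 0) (Fin.succAbove 0)).det)
    (hf₁ : ∀ y, MvPolynomial.eval y f₁ =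
      ((matAt M y).submatrix (Fin.succAbove 1) (Fin.succAbove 1)).det)
    {e : Fin 3 → ℝ} (h₀ : Interlaces 2 h f₀ e) (h₁ : Interlaces 2 h f₁ e) :
    ∃ e', (e' = e ∨ e' = -e) ∧ ∃ t : ℝ, (t • nodeNormalForm + matAt M e').PosDef := by
  let L : Fin 4 → Fin 3 → Matrix (Fin 3) (Fin 3) ℝ :=
    fun k j => (M j).submatrix k.succAbove k.succAbove
  have hL : ∀ k y, matAt (L k) y = (matAt M y).submatrix k.succAbove k.succAbove :=
    fun k y => matAt_submatrix M _ y
  have hs := isSymm_matAt hM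
  -- Over the conic, one of the two rows may be assumed to annihilate the kernel of the block.
  have hline : ∀ i j : Fin 4, (∀ l : Fin 4, l = i ∨ l = j ∨ l = 2 ∨ l = 3) →
      ¬ ∀ (y : Fin 3 → ℝ) (w₁ w₂ : ℝ), matAt M y 2 2 = w₁ ^ 2 → matAt M y 2 3 = w₁ * w₂ →
        matAt M y 3 3 = w₂ ^ 2 → matAt M y i 2 * w₂ - matAt M y i 3 * w₁ = 0 := by
    intro i j hij hcon
    obtain ⟨y, w₁, w₂, hw, h22, h23, h33, hj⟩ := exists_point_on_conic hsurj j
    have hi := hcon y w₁ w₂ h22 h23 h33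
    have h32 := (hs y).apply 2 3
    have hy : y = 0 := by
      refine hker y ![0, 0, w₂, -w₁] rfl rfl (fun h0 => hw ?_) ?_
      · have a := congrFun h0 2
        have b := congrFun h0 3
        simp at a b
        exact ⟨b, a⟩
      · ext l
        have hrow : (matAt M y *ᵥ ![0, 0, w₂, -w₁]) l =
            matAt M y l 2 * w₂ - matAt M y l 3 * w₁ := by
          simp [mulVec, dotProduct, Fin.sum_univ_four]
          ring
        rw [hrow]
        rcases hij l with rfl | rfl | rfl | rfl
        · exact hi
        · exact hj
        · rw [h22, h23]; simp; ring
        · rw [h32, h23, h33]; simp; ring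
    subst hy
    have h0 : matAt M (0 : Fin 3 → ℝ) = 0 := by simp [matAt]
    rw [h0] at h22 h33
    exact hw ⟨pow_eq_zero_iff two_ne_zero |>.1 h22.symm, pow_eq_zero_iff two_ne_zero |>.1 h33.symm⟩
  obtain ⟨hQ, hp₀⟩ := definite_of_interlaces (L := L 0) (fun i => (hM i).submatrix _)
    (fun a b c => (hsurj a b c).imp fun y h => by rw [hL]; exact h)
    (fun h => hline 1 0 (by decide) fun y w₁ w₂ h1 h2 h3 => by
      have h4 := h y w₁ w₂
      rw [hL] at h4
      exact h4 h1 h2 h3) one_ne_zero hd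
    (fun y => by rw [hf₀, hL, one_mul]) (fun y => by rw [hh, hL]; rfl) h₀
  obtain ⟨-, hp₁⟩ := definite_of_interlaces (L := L 1) (fun i => (hM i).submatrix _)
    (fun a b c => (hsurj a b c).imp fun y h => by rw [hL]; exact h)
    (fun h => hline 0 1 (by decide) fun y w₁ w₂ h1 h2 h3 => by
      have h4 := h y w₁ w₂
      rw [hL] at h4
      exact h4 h1 h2 h3) one_ne_zero hd
    (fun y => by rw [hf₁, hL, one_mul]) (fun y => by rw [hh, hL]; rfl) h₁
  rw [hL] at hQ hp₀ hp₁
  change 0 < matAt M e 2 2 * matAt M e 3 3 - matAt M e 2 3 ^ 2 at hQ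
  change 0 < matAt M e 2 2 * _ at hp₀
  change 0 < matAt M e 2 2 * _ at hp₁
  have hnegdet : ∀ (X : Matrix (Fin 4) (Fin 4) ℝ) (k : Fin 4),
      ((-X).submatrix k.succAbove k.succAbove).det =
        -(X.submatrix k.succAbove k.succAbove).det := fun X k => by
    change (-(X.submatrix k.succAbove k.succAbove)).det = _
    rw [det_neg]
    simp; norm_num
  rcases lt_trichotomy (matAt M e 2 2) 0 with hneg | hzero | hpos
  · refine ⟨-e, Or.inr rfl, exists_posDef_completion (hs _) ?_ ?_ ?_ ?_⟩
    · simpa [matAt_neg] using hneg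
    · simpa [matAt_neg] using hQ
    · rw [matAt_neg, hnegdet]
      exact neg_pos.2 (neg_of_mul_pos_right hp₀ hneg.le)
    · rw [matAt_neg, hnegdet]
      exact neg_pos.2 (neg_of_mul_pos_right hp₁ hneg.le)
  · rw [hzero, zero_mul] at hp₀
    exact absurd hp₀ (lt_irrefl _)
  · exact ⟨e, Or.inl rfl, exists_posDef_completion (hs _) hpos hQ
      (pos_of_mul_pos_right hp₀ hpos.le) (pos_of_mul_pos_right hp₁ hpos.le)⟩

theorem ne_zero_of_posDef_matAt {A : Fin 4 → Matrix (Fin 4) (Fin 4) ℝ} {v : Fin 4 → ℝ}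
    (hv : (matAt A v).PosDef) : v ≠ 0 := by
  rintro rfl
  have := hv.diag_pos (i := 0)
  simp [matAt] at this

/-- Unless the determinant vanishes identically, a spectrahedron has an interior point if and only
if the pencil contains a definite matrix. -/
theorem hasInteriorPoint_spectrahedron_iff {A : Fin 4 → Matrix (Fin 4) (Fin 4) ℝ}
    (hA : ∀ i, (A i).IsSymm) (hdet : detForm A ≠ 0) :
    HasInteriorPoint (spectrahedron A) ↔ ∃ v, (matAt A v).PosDef := by
  constructor
  · rintro ⟨u, hu⟩
    obtain ⟨r, hr, hball⟩ := Metric.isOpen_iff.1 isOpen_interior u hu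
    obtain ⟨v, hv, hfv⟩ : ∃ v ∈ Metric.ball u r, MvPolynomial.eval v (detForm A) ≠ 0 := by
      by_contra! hcon
      refine hdet (MvPolynomial.funext_set (fun i => Metric.ball (u i) r) (fun i => ?_)
        fun v hv => ?_)
      · rw [Real.ball_eq_Ioo]
        exact Set.Ioo_infinite (by linarith)
      · rw [← ball_pi u hr] at hv
        rw [hcon v hv, map_zero]
    have hv0 : v ≠ 0 := by
      rintro rfl
      refine hfv ?_
      rw [eval_detForm]
      simp [matAt]
    have hsemi := (mk_mem_spectrahedron_iff A v hv0).1 (interior_subset (hball hv) hv0)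
    rw [eval_detForm] at hfv
    have hunit : IsUnit (matAt A v) := (isUnit_iff_isUnit_det _).2 hfv.isUnit
    rcases hsemi with h | h
    · exact ⟨v, h.posDef_iff_isUnit.2 hunit⟩
    · exact ⟨-v, by rw [matAt_neg]; exact h.posDef_iff_isUnit.2 hunit.neg⟩
  · rintro ⟨v, hv⟩
    refine ⟨v, mem_interior.2 ⟨{v | (matAt A v).PosDef}, fun w hw hw0 => ?_,
      isOpen_posDef (continuous_matAt A) (isSymm_matAt hA), hv⟩⟩
    exact (mk_mem_spectrahedron_iff A w hw0).2 (Or.inl (PosDef.posSemidef hw))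

end Symmetroid

open Symmetroid Matrix in

theorem proposition4p4
    (A : Fin 4 → Matrix (Fin 4) (Fin 4) ℝ) (hA : ∀ i, (A i).IsSymm)
    (p : Fin 4 → ℝ)
    (hnode : Symmetroid.IsNode (Symmetroid.detForm A) p)
    (hsig : Symmetroid.HasSignature (Symmetroid.matAt A p) 1 1)
    (hline : ¬ Symmetroid.ContainsLineThrough (Symmetroid.detForm A) p)
    (T : (Fin 4 → ℝ) ≃ₗ[ℝ] (Fin 4 → ℝ)) (hT : T (Pi.single 0 1) = p)
    (P : Matrix (Fin 4) (Fin 4) ℝ) (hP : IsUnit P.det)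
    (hPp : Pᵀ * Symmetroid.matAt A p * P = Symmetroid.nodeNormalForm)
    (S : Set (ℙ ℝ (Fin 4 → ℝ))) (hS : S = Symmetroid.spectrahedron A)
    (Cp R₁ R₂ : MvPolynomial (Fin 3) ℝ)
    (hCp : Cp = Symmetroid.tangentConic (Symmetroid.detForm (Symmetroid.inCoords A T)))
    (hR₁ : R₁ = Symmetroid.ramificationCubic A T P 0)
    (hR₂ : R₂ = Symmetroid.ramificationCubic A T P 1) :
    -- the spectrahedron is full-dimensional iff the conic interlaces both cubics
    (Symmetroid.HasInteriorPoint S ↔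
      ∃ e, Symmetroid.Interlaces 2 Cp R₁ e ∧ Symmetroid.Interlaces 2 Cp R₂ e) ∧
    -- if all singular points on `S` are nodes of rank two, it suffices that `S` is non-empty
    ((∀ x : Fin 4 → ℝ, Symmetroid.IsSingularPoint (Symmetroid.detForm A) x →
        Symmetroid.IsSemidefinite (Symmetroid.matAt A x) →
        Symmetroid.IsNode (Symmetroid.detForm A) x ∧ (Symmetroid.matAt A x).rank = 2) →
      (S.Nonempty ↔
        ∃ e, Symmetroid.Interlaces 2 Cp R₁ e ∧ Symmetroid.Interlaces 2 Cp R₂ e)) ∧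
    -- the image of `S` is the intersection of the convex hulls of the ovals
    (∀ e, Symmetroid.Interlaces 2 Cp R₁ e → Symmetroid.Interlaces 2 Cp R₂ e →
      Symmetroid.projectionImage T S =
        Symmetroid.ovalHull R₁ e ∩ Symmetroid.ovalHull R₂ e) := by

  have hdet : P.det ^ 2 ≠ 0 := pow_ne_zero 2 hP.ne_zero
  let B : Fin 4 → Matrix (Fin 4) (Fin 4) ℝ := fun i => Pᵀ * inCoords A T i * P
  have hBs : ∀ i, (B i).IsSymm := fun i => isSymm_congr (isSymm_matAt hA _) P
  have hB0 : B 0 = nodeNormalForm := by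
    rw [← hPp, ← hT]; rfl
  have hBx : ∀ x, matAt B x = Pᵀ * matAt A (T x) * P := fun x => by
    rw [← matAt_inCoords, ← matAt_congr]
  let M : Fin 3 → Matrix (Fin 4) (Fin 4) ℝ := fun j => B j.succ
  have hMs : ∀ i, (M i).IsSymm := fun j => hBs j.succ
  have hcons : ∀ (t : ℝ) (y : Fin 3 → ℝ), Pᵀ * matAt A (T (Fin.cons t y : Fin 4 → ℝ)) * P =
      t • nodeNormalForm + matAt M y := fun t y => by rw [← hBx, matAt_cons, hB0]
  have hsurj : ∀ a b c : ℝ, ∃ y, matAt M y 2 2 = a ∧ matAt M y 2 3 = b ∧ matAt M y 3 3 = c := by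
    intro a b c
    have hp : matAt (fun i => Pᵀ * A i * P) p = nodeNormalForm := (matAt_congr A P p).trans hPp
    obtain ⟨v, h1, h2, h3⟩ := exists_matAt_eq_of_rank_hessian (B := fun i => Pᵀ * A i * P)
      (x := p) (fun i => isSymm_congr (hA i) P)
      (fun i => by rw [hp]; fin_cases i <;> rfl) (fun i => by rw [hp]; fin_cases i <;> rfl)
      ((rank_hessian_congr hP p).trans hnode.2) a b c
    have hv : matAt (fun i => Pᵀ * A i * P) v =
        T.symm v 0 • nodeNormalForm + matAt M (Fin.tail (T.symm v)) := by
      rw [← hcons, Fin.cons_self_tail, matAt_congr, T.apply_symm_apply]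
    rw [hv] at h1 h2 h3
    exact ⟨Fin.tail (T.symm v), by simpa [nodeNormalForm] using h1,
      by simpa [nodeNormalForm] using h2, by simpa [nodeNormalForm] using h3⟩
  have hker : ∀ (y : Fin 3 → ℝ) (k : Fin 4 → ℝ), k 0 = 0 → k 1 = 0 → k ≠ 0 →
      matAt M y *ᵥ k = 0 → y = 0 := by
    intro y k hk0 hk1 hk hyk
    by_contra hy
    have hcancel : ∀ X : Matrix (Fin 4) (Fin 4) ℝ, (Pᵀ * X * P) *ᵥ k = 0 → X *ᵥ (P *ᵥ k) = 0 := by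
      intro X hX
      rw [← mulVec_mulVec, ← mulVec_mulVec] at hX
      exact (mulVec_injective_iff_isUnit.2
        ((isUnit_iff_isUnit_det _).2 (by rwa [det_transpose]))) (hX.trans (mulVec_zero _).symm)
    have hNk : nodeNormalForm *ᵥ k = 0 := by
      ext i
      fin_cases i <;> simp [mulVec, dotProduct, Fin.sum_univ_four, nodeNormalForm, hk0, hk1]
    refine hline (containsLineThrough_of_common_kernel (v := T (Fin.cons 0 y : Fin 4 → ℝ))
      (z := P *ᵥ k) ?_ (fun h0 => hk ?_) (hcancel _ (by rw [hPp, hNk])) (hcancel _ ?_))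
    · rw [LinearIndependent.pair_iff]
      intro s t hst
      rw [← hT, ← map_smul, ← map_smul, ← map_add, T.map_eq_zero_iff] at hst
      have hs0 : s = 0 := by simpa using congrFun hst 0
      refine ⟨hs0, ?_⟩
      obtain ⟨i, hi⟩ := Function.ne_iff.1 hy
      have := congrFun hst i.succ
      simp only [Pi.add_apply, Pi.smul_apply, smul_eq_mul, Fin.cons_succ, hs0, zero_mul, zero_add,
        Pi.zero_apply] at this
      exact (mul_eq_zero.1 this).resolve_right hi
    · exact (mulVec_injective_iff_isUnit.2 ((isUnit_iff_isUnit_det _).2 hP))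
        (h0.trans (mulVec_zero _).symm)
    · rw [hcons, zero_smul, zero_add, hyk]
  have hconic : ∀ y, MvPolynomial.eval y Cp =
      -(P.det ^ 2)⁻¹ * (matAt M y 2 2 * matAt M y 3 3 - matAt M y 2 3 ^ 2) := by
    intro y
    have h1 := tangentConic_congr (inCoords A T) P y
    rw [← hCp] at h1
    have h2 : MvPolynomial.eval y (tangentConic (detForm B)) = _ := eval_tangentConic hBs hB0 y
    have h3 := h1.symm.trans h2
    rw [neg_mul, ← mul_neg, eq_inv_mul_iff_mul_eq₀ hdet]
    exact h3
  have hd : -(P.det ^ 2)⁻¹ ≠ 0 := neg_ne_zero.2 (inv_ne_zero hdet)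
  have hcubic : ∀ k : Fin 4, ∀ y, MvPolynomial.eval y (ramificationCubic A T P k) =
      ((matAt M y).submatrix k.succAbove k.succAbove).det := fun k y => by
    rw [← matAt_submatrix, ← eval_detForm]; rfl
  have hf₀ : ∀ y, MvPolynomial.eval y R₁ =
      ((matAt M y).submatrix (Fin.succAbove 0) (Fin.succAbove 0)).det :=
    fun y => by rw [hR₁]; exact hcubic 0 y
  have hf₁ : ∀ y, MvPolynomial.eval y R₂ =
      ((matAt M y).submatrix (Fin.succAbove 1) (Fin.succAbove 1)).det :=
    fun y => by rw [hR₂]; exact hcubic 1 y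
  have hpd : (∃ v, (matAt A v).PosDef) ↔ ∃ e, Interlaces 2 Cp R₁ e ∧ Interlaces 2 Cp R₂ e := by
    constructor
    · rintro ⟨v, hv⟩
      have hB : (T.symm v 0 • nodeNormalForm + matAt M (Fin.tail (T.symm v))).PosDef := by
        rw [← hcons, Fin.cons_self_tail, T.apply_symm_apply]
        exact (posDef_congr_iff hP _).2 hv
      refine ⟨Fin.tail (T.symm v), ?_, ?_⟩
      · refine interlaces_of_posDef
          (L := fun j => (M j).submatrix (Fin.succAbove 0) (Fin.succAbove 0))
          (fun i => (hMs i).submatrix _) one_ne_zero hd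
          (fun y => by rw [hf₀, matAt_submatrix, one_mul])
          (fun y => by rw [hconic, matAt_submatrix, lowerMinor]; rfl) ?_
        have := hB.submatrix (Fin.succAbove_right_injective (p := (0 : Fin 4)))
        rwa [submatrix_smul_nodeNormalForm_add (Or.inl rfl), ← matAt_submatrix] at this
      · refine interlaces_of_posDef
          (L := fun j => (M j).submatrix (Fin.succAbove 1) (Fin.succAbove 1))
          (fun i => (hMs i).submatrix _) one_ne_zero hd
          (fun y => by rw [hf₁, matAt_submatrix, one_mul])
          (fun y => by rw [hconic, matAt_submatrix, lowerMinor]; rfl) ?_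
        have := hB.submatrix (Fin.succAbove_right_injective (p := (1 : Fin 4)))
        rwa [submatrix_smul_nodeNormalForm_add (Or.inr rfl), ← matAt_submatrix] at this
    · rintro ⟨e, h₀, h₁⟩
      obtain ⟨e', -, t, ht⟩ := exists_posDef_of_interlaces hMs hsurj hker hd hconic hf₀ hf₁ h₀ h₁
      exact ⟨T (Fin.cons t e' : Fin 4 → ℝ), (posDef_congr_iff hP _).1 (by rwa [hcons])⟩
  subst hS
  refine ⟨?_, fun hsing => ?_, fun e h₀ h₁ => ?_⟩
  · rw [← hpd]
    refine hasInteriorPoint_spectrahedron_iff hA fun h0 => ?_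
    have hr := hnode.2
    rw [h0] at hr
    have hz : (Matrix.of fun i j : Fin 4 => MvPolynomial.eval p (MvPolynomial.pderiv i
      (MvPolynomial.pderiv j (0 : MvPolynomial (Fin 4) ℝ)))) = 0 := by ext; simp
    rw [hz, rank_zero] at hr
    exact absurd hr (by norm_num)
  · rw [← hpd]
    constructor
    · rintro ⟨x, hx⟩
      have hx0 := x.rep_nonzero
      rcases hx with h | h
      · exact exists_posDef_of_posSemidef hA hx0 h fun hs => hsing _ hs (Or.inl h)
      · rw [← matAt_neg] at h
        exact exists_posDef_of_posSemidef hA (neg_ne_zero.2 hx0) h fun hs => hsing _ hs (Or.inl h)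
    · rintro ⟨v, hv⟩
      exact ⟨Projectivization.mk ℝ v (ne_zero_of_posDef_matAt hv),
        (mk_mem_spectrahedron_iff A v _).2 (Or.inl hv.posSemidef)⟩
  · obtain ⟨e', he', t, ht⟩ := exists_posDef_of_interlaces hMs hsurj hker hd hconic hf₀ hf₁ h₀ h₁
    have hdef : ∀ k : Fin 4, k = 0 ∨ k = 1 →
        ((matAt M e').submatrix k.succAbove k.succAbove).PosDef := fun k hk => by
      have := ht.submatrix (Fin.succAbove_right_injective (p := k))
      rwa [submatrix_smul_nodeNormalForm_add hk] at this
    have hoval : ∀ k : Fin 4, k = 0 ∨ k = 1 → ovalHull (ramificationCubic A T P k) e =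
        {y | ∃ (v : Fin 3 → ℝ) (hv : v ≠ 0),
          ((matAt M v).submatrix k.succAbove k.succAbove).PosSemidef ∧
            Projectivization.mk ℝ v hv = y} := by
      intro k hk
      have h := ovalHull_eq_of_definite (L := fun j => (M j).submatrix k.succAbove k.succAbove)
        (fun i => (hMs i).submatrix _)
        (fun a b c => (hsurj a b c).imp fun y h => by
          rw [matAt_submatrix]; rcases hk with rfl | rfl <;> exact h) one_ne_zero
        (fun y => by rw [hcubic, matAt_submatrix, one_mul]) (e := e) (by
          rcases he' with rfl | rfl
          · exact Or.inl (by rw [matAt_submatrix]; exact hdef k hk)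
          · exact Or.inr (by rw [matAt_submatrix]; exact hdef k hk))
      simpa only [matAt_submatrix] using h
    rw [hR₁, hR₂, hoval 0 (Or.inl rfl), hoval 1 (Or.inr rfl)]
    ext y
    constructor
    · rintro ⟨s, v, hv, hx, hmem, rfl⟩
      have hsemi := (mk_mem_spectrahedron_iff A _ hx).1 hmem
      rw [← isSemidefinite_congr_iff hP, hcons] at hsemi
      obtain ⟨s', v', hv', hmk, hpsd⟩ : ∃ (s' : ℝ) (v' : Fin 3 → ℝ) (hv' : v' ≠ 0),
          Projectivization.mk ℝ v' hv' = Projectivization.mk ℝ v hv ∧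
            (s' • nodeNormalForm + matAt M v').PosSemidef := by
        rcases hsemi with h | h
        · exact ⟨s, v, hv, rfl, h⟩
        · refine ⟨-s, -v, neg_ne_zero.2 hv,
            (Projectivization.mk_eq_mk_iff' ℝ _ _ _ _).2 ⟨-1, by simp⟩, ?_⟩
          rwa [matAt_neg, neg_smul, ← neg_add]
      have hk : ∀ k : Fin 4, k = 0 ∨ k = 1 →
          ((matAt M v').submatrix k.succAbove k.succAbove).PosSemidef := fun k hk => by
        have := hpsd.submatrix k.succAbove
        rwa [submatrix_smul_nodeNormalForm_add hk] at this
      exact ⟨⟨v', hv', hk 0 (Or.inl rfl), hmk⟩, ⟨v', hv', hk 1 (Or.inr rfl), hmk⟩⟩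
    · rintro ⟨⟨v, hv, hv0, rfl⟩, ⟨w, hw, hw1, hwv⟩⟩
      obtain ⟨a, rfl⟩ := (Projectivization.mk_eq_mk_iff' ℝ _ _ hw hv).1 hwv
      have hv1 : ((matAt M v).submatrix (Fin.succAbove 1) (Fin.succAbove 1)).PosSemidef := by
        have ha0 : a ≠ 0 := by rintro rfl; simp at hw
        rcases ha0.lt_or_gt with ha | ha
        · -- Representatives of opposite sign would make the common block vanish at `v`.
          exfalso
          rw [matAt_smul] at hw1
          have p22 : 0 ≤ matAt M v 2 2 := hv0.diag_nonneg (i := 1)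
          have p33 : 0 ≤ matAt M v 3 3 := hv0.diag_nonneg (i := 2)
          have q22 : 0 ≤ a * matAt M v 2 2 := hw1.diag_nonneg (i := 1)
          have q33 : 0 ≤ a * matAt M v 3 3 := hw1.diag_nonneg (i := 2)
          have z22 : matAt M v 2 2 = 0 := by nlinarith
          have z33 : matAt M v 3 3 = 0 := by nlinarith
          have z23 : matAt M v 2 3 = 0 := by
            have hdn := (hv0.submatrix (Fin.succ : Fin 2 → Fin 3)).det_nonneg
            rw [det_fin_two] at hdn
            change 0 ≤ matAt M v 2 2 * matAt M v 3 3 - matAt M v 2 3 * matAt M v 3 2 at hdn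
            rw [(isSymm_matAt hMs v).apply 2 3, z22, z33] at hdn
            nlinarith
          let φ : (Fin 3 → ℝ) →ₗ[ℝ] (Fin 3 → ℝ) :=
            { toFun := fun y => ![matAt M y 2 2, matAt M y 2 3, matAt M y 3 3]
              map_add' := fun x y => by simp [matAt_add]
              map_smul' := fun c x => by simp [matAt_smul] }
          have hφ : Function.Surjective φ := fun u => by
            obtain ⟨y, h1, h2, h3⟩ := hsurj (u 0) (u 1) (u 2)
            refine ⟨y, ?_⟩
            ext i
            fin_cases i
            · exact h1
            · exact h2
            · exact h3
          refine hv ((LinearMap.injective_iff_surjective.2 hφ) (?_ : φ v = φ 0))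
          rw [map_zero]
          ext i
          fin_cases i
          · exact z22
          · exact z23
          · exact z33
        · rw [matAt_smul] at hw1
          convert hw1.smul (inv_pos.2 ha).le using 1
          ext i j
          simp [ha0]
      obtain ⟨s, hs⟩ := exists_posSemidef_completion hMs (hdef 0 (Or.inl rfl))
        (hdef 1 (Or.inr rfl)) hv0 hv1
      have hx : T (Fin.cons s v : Fin 4 → ℝ) ≠ 0 := by
        rw [Ne, T.map_eq_zero_iff]
        intro h
        exact hv (funext fun i => by simpa using congrFun h i.succ)
      refine ⟨s, v, hv, hx, (mk_mem_spectrahedron_iff A _ hx).2 ?_, rfl⟩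
      rw [← isSemidefinite_congr_iff hP, hcons]
      exact Or.inl hs
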